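/- Let $h\in C^\infty(\mathbb R)$ be real-valued and $\mu\in\mathbb R$. Assume: (1) there are $\beta_1>0$, $c>0$ with $h(\xi)\ge c|\xi|^{\beta_1}$ for all sufficiently large $|\xi|$, and there is $\beta_2\ge 0$ such that for every $n\ge 1$ there is a constant $C_n$ with $|h^{(n)}(\xi)|\le C_n(1+|\xi|)^{\beta_2}$ for all $\xi\in\mathbb R$; (2) $h'(\xi)\ne 0$ whenever $h(\xi)=\mu$; (3) the Fermi sea $\Omega=\{\xi\in\mathbb R: h(\xi)<\mu\}$ has finitely many connected components; let $N$ be their number. For $T>0$ let $a_{T,\mu}(\xi)=\bigl(1+\exp\bigl((h(\xi)-\mu)/T\bigr)\bigr)^{-1}$, $\xi\in\mathbb R$. Let $n\ge 1$ be an integer, $t_0\in\mathbb R$, $\gamma>0$, $0<R\le 1$, and let $f:\mathbb R\to\mathbb C$ be continuous on $\mathbb R$, of class $C^n$ on $\mathbb R\setminus\{t_0\}$, equal to zero outside $(t_0-R,t_0+R)$, and such that $$\max_{0\le k\le n}\ \sup_{t\ne t_0}|f^{(k)}(t)|\,|t-t_0|^{-\gamma+k}<\infty .$$ For $s_1,s_2\in\mathbb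 R$ and a function $a:\mathbb R\to\mathbb R$ put $$U(s_1,s_2;f)=\int_0^1\frac{f\bigl((1-t)s_1+ts_2\bigr)-\bigl[(1-t)f(s_1)+tf(s_2)\bigr]}{t(1-t)}\,dt,$$ $$\mathcal B(a;f)=\frac1{8\pi^2}\lim_{\varepsilon\downarrow0}\iint_{|\xi_1-\xi_2|>\varepsilon}\frac{U\bigl(a(\xi_1),a(\xi_2);f\bigr)}{|\xi_1-\xi_2|^2}\,d\xi_1\,d\xi_2 .$$ Then $U(1,0;f)$ is well defined, and for all sufficiently small $T>0$ the Widom coefficient $\mathcal B(a_{T,\mu};f)$ is well defined (the integrals converge absolutely and the limit exists and is finite). Moreover, as $T\downarrow0$, $$\mathcal B(a_{T,\mu};f)=\frac{N}{2\pi^2}\,U(1,0;f)\,|\log T|+O(1).$$ -/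

import Mathlib

open MeasureTheory Filter Topology Asymptotics

noncomputable section

/-- The conditions on a one-particle Hamiltonian `h` in dimension one, at chemical potential `μ`:
smoothness, growth at infinity, polynomially bounded derivatives with one exponent for all orders,
nondegeneracy on the Fermi surface `{h = μ}`, and finitely many components of `{h < μ}`. -/
structure FermiSurfaceCondition (h : ℝ → ℝ) (μ : ℝ) : Prop where
  smooth : ContDiff ℝ ((⊤ : ℕ∞) : WithTop ℕ∞) h
  growth : ∃ β₁ > (0 : ℝ), ∃ c > (0 : ℝ), ∃ ρ : ℝ, ∀ ξ : ℝ, ρ ≤ |ξ| → c * |ξ| ^ β₁ ≤ h ξ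
  deriv_bound : ∃ β₂ : ℝ, 0 ≤ β₂ ∧ ∀ n : ℕ, 1 ≤ n →
    ∃ C : ℝ, ∀ ξ : ℝ, |iteratedDeriv n h ξ| ≤ C * (1 + |ξ|) ^ β₂
  nondegenerate : ∀ ξ : ℝ, h ξ = μ → deriv h ξ ≠ 0
  finite_components : Finite (ConnectedComponents {ξ : ℝ // h ξ < μ})

/-- The number of connected components of the Fermi sea `{ξ | h ξ < μ}`. -/
def fermiSeaComponents (h : ℝ → ℝ) (μ : ℝ) : ℕ :=
  Nat.card (ConnectedComponents {ξ : ℝ // h ξ < μ})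

/-- The Fermi symbol at temperature `T` and chemical potential `μ`. -/
def fermiSymbol (h : ℝ → ℝ) (T μ ξ : ℝ) : ℝ :=
  1 / (1 + Real.exp ((h ξ - μ) / T))

/-- `f` is continuous, `n` times continuously differentiable off `t₀`, has
`|f⁽ᵏ⁾(t)| |t - t₀|^(-γ + k)` bounded on `t ≠ t₀` for `0 ≤ k ≤ n`,
and vanishes off the interval `(t₀ - R, t₀ + R)`. -/
structure HolderTypeCondition (f : ℝ → ℂ) (n : ℕ) (t₀ γ R : ℝ) : Prop where
  continuous : Continuous f
  contDiffOn : ContDiffOn ℝ (n : WithTop ℕ∞) f {t₀}ᶜ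
  bound : ∃ M : ℝ, ∀ k : ℕ, k ≤ n → ∀ t : ℝ, t ≠ t₀ →
    ‖iteratedDeriv k f t‖ * |t - t₀| ^ (-γ + (k : ℝ)) ≤ M
  support : ∀ t : ℝ, R ≤ |t - t₀| → f t = 0

/-- The integrand in the definition of `U(s₁, s₂; g)`. -/
def widomUIntegrand (s₁ s₂ : ℝ) (g : ℝ → ℂ) (t : ℝ) : ℂ :=
  (g ((1 - t) * s₁ + t * s₂) - ((1 - (t : ℂ)) * g s₁ + (t : ℂ) * g s₂)) /
    ((t : ℂ) * (1 - (t : ℂ)))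

/-- `U(s₁, s₂; g)`. -/
def widomU (s₁ s₂ : ℝ) (g : ℝ → ℂ) : ℂ :=
  ∫ t in (0 : ℝ)..1, widomUIntegrand s₁ s₂ g t

/-- The integrand `U(a(ξ₁), a(ξ₂); g) / |ξ₁ - ξ₂|²`. -/
def widomKernel (a : ℝ → ℝ) (g : ℝ → ℂ) (p : ℝ × ℝ) : ℂ :=
  widomU (a p.1) (a p.2) g / ((|p.1 - p.2| ^ 2 : ℝ) : ℂ)

/-- The double integral over `|ξ₁ - ξ₂| > ε`. -/
def widomTruncated (a : ℝ → ℝ) (g : ℝ → ℂ) (ε : ℝ) : ℂ :=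
  ∫ p in {p : ℝ × ℝ | ε < |p.1 - p.2|}, widomKernel a g p

/-- The Widom coefficient `𝓑(a; g)`. -/
def widomCoefficient (a : ℝ → ℝ) (g : ℝ → ℂ) : ℂ :=
  (1 / (8 * (Real.pi : ℂ) ^ 2)) * limUnder (𝓝[>] (0 : ℝ)) (widomTruncated a g)

/-- All integrals and the limit in the definition of `𝓑(a; g)` exist (in the sense of Lebesgue
integrals and of convergence in `ℂ`), so that `widomCoefficient a g` is not a default value. -/
structure WidomCoefficientExists (a : ℝ → ℝ) (g : ℝ → ℂ) : Prop where
  inner : ∀ ξ₁ ξ₂ : ℝ,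
    IntervalIntegrable (widomUIntegrand (a ξ₁) (a ξ₂) g) volume 0 1
  double : ∀ ε > (0 : ℝ),
    IntegrableOn (widomKernel a g) {p : ℝ × ℝ | ε < |p.1 - p.2|}
  limit : ∃ L : ℂ, Tendsto (widomTruncated a g) (𝓝[>] (0 : ℝ)) (𝓝 L)

end

/-! Write v = h - μ, let a be the Fermi symbol, and put J(d) = ∫ U(a(ξ), a(ξ+d); f) dξ
(`widomShift`). The substitution ξ₂ = ξ₁ + d turns the double integral into ∫ J(d) / d² dd over |d|
> ε (`widomTruncated_eq`), so everything reduces to the size of J in three ranges of d.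

For |d| ≤ T the symbol is smooth at scale d, and J(d) = O(d²/T)
(`exists_norm_widomShift_le_of_abs_le`). By translation invariance, the linear interpolation of f
between the end values may be replaced under the ξ-integral by f(a(ξ+td)). What remains compares f
at a linear interpolation of a with f at a itself; the arguments differ by a second-order Taylor
remainder. As f is only Hölder at t₀, this costs a factor |a - t₀|^(σ-1), which is integrable
against -φ', φ being the Fermi function, because s ↦ |s - t₀|^(σ-1) is locally integrable.

For larger d the symbol is close to the indicator of the Fermi sea: J(d) = U(1,0;f) · `crossing` +
O(T) uniformly in d (`exists_norm_widomShift_sub_le`). Nondegeneracy keeps the components of the sea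
apart, so the crossing measure is exactly 2N|d| for small |d| (`eventually_crossing_eq`). For d
beyond a fixed radius, J is merely bounded.

Hence ∫ J/d² is O(1) from |d| ≤ T, plus 2N U(1,0;f) · 2 log(r/T) + O(1) from T < |d| ≤ r, plus O(1)
(`integrable_div_sq_and_norm_integral_sub_log_le`). Dividing 4N by 8π² gives the coefficient
N/(2π²). The same bounds make J/d² integrable, so the limit in ε exists. -/

/-! ### Hölder bounds for the test function -/

/-- `f` is globally Hölder with exponent `σ`, and is Lipschitz at distance `r` from `t₀` with
constant of order `r ^ (σ - 1)`. -/
structure HolderOffPoint (f : ℝ → ℂ) (t₀ σ M : ℝ) : Prop where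
  continuous : Continuous f
  exponent_pos : 0 < σ
  exponent_lt : σ < 1
  const_nonneg : 0 ≤ M
  holder : ∀ x y : ℝ, ‖f x - f y‖ ≤ M * |x - y| ^ σ
  lipschitz : ∀ x y : ℝ, y ≠ t₀ → ‖f x - f y‖ ≤ M * (|x - y| * |y - t₀| ^ (σ - 1))

theorem holderOffPoint_of_growth {f : ℝ → ℂ} {t₀ σ M : ℝ} (hc : Continuous f) (h0 : 0 < σ)
    (h1 : σ < 1) (hM : 0 ≤ M) (hf : ∀ t, ‖f t‖ ≤ M * |t - t₀| ^ σ)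
    (hd : ∀ t, t ≠ t₀ → DifferentiableAt ℝ f t)
    (hf' : ∀ t, t ≠ t₀ → ‖deriv f t‖ ≤ M * |t - t₀| ^ (σ - 1)) :
    HolderOffPoint f t₀ σ (10 * M) := by
  have key : ∀ x y : ℝ, y ≠ t₀ → x ≠ y → ‖f x - f y‖ ≤ 10 * M * |x - y| ^ σ ∧
      ‖f x - f y‖ ≤ 10 * M * (|x - y| * |y - t₀| ^ (σ - 1)) := by
    intro x y hy hxy
    have hr : 0 < |y - t₀| := abs_pos.2 (sub_ne_zero.2 hy)
    have hD : 0 < |x - y| := abs_pos.2 (sub_ne_zero.2 hxy)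
    set r := |y - t₀| with hr_def
    set D := |x - y| with hD_def
    have hDσ : D ^ σ = D * D ^ (σ - 1) := by
      rw [Real.rpow_sub_one hD.ne']; field_simp
    have half : (r / 2) ^ (σ - 1) ≤ 2 * r ^ (σ - 1) := by
      rw [Real.div_rpow hr.le zero_le_two, div_eq_mul_inv, ← Real.rpow_neg zero_le_two, mul_comm]
      gcongr
      calc (2 : ℝ) ^ (-(σ - 1)) ≤ 2 ^ (1 : ℝ) :=
            Real.rpow_le_rpow_of_exponent_le one_le_two (by linarith)
        _ = 2 := Real.rpow_one 2
    have hcσ : ∀ c : ℝ, 1 ≤ c → (c * D) ^ σ ≤ c * D ^ σ := by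
      intro c hc1
      rw [Real.mul_rpow (by linarith) hD.le]
      gcongr
      calc c ^ σ ≤ c ^ (1 : ℝ) := Real.rpow_le_rpow_of_exponent_le hc1 h1.le
        _ = c := Real.rpow_one c
    rcases le_or_gt (r / 2) D with hcase | hcase
    -- When D is at least r / 2, both points lie within 3D of t₀, so the growth bound alone
    -- suffices.
    · have hx : |x - t₀| ≤ 3 * D := by
        have : |x - t₀| ≤ |x - y| + |y - t₀| := abs_sub_le _ _ _
        linarith
      have e1 : ‖f x‖ ≤ M * (3 * D ^ σ) := (hf x).trans <| by
        gcongr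
        exact (Real.rpow_le_rpow (abs_nonneg _) hx h0.le).trans (hcσ 3 (by norm_num))
      have e2 : ‖f y‖ ≤ M * (2 * D ^ σ) := (hf y).trans <| by
        gcongr
        exact (Real.rpow_le_rpow hr.le (by linarith) h0.le).trans (hcσ 2 (by norm_num))
      have e3 : ‖f x - f y‖ ≤ 5 * M * D ^ σ := by
        have := norm_sub_le (f x) (f y); nlinarith
      have hp : 0 ≤ D ^ σ := by positivity
      refine ⟨e3.trans (by nlinarith [mul_nonneg hM hp]), e3.trans ?_⟩
      have e4 : D ^ (σ - 1) ≤ 2 * r ^ (σ - 1) :=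
        (Real.rpow_le_rpow_of_nonpos (by linarith) hcase (by linarith)).trans half
      rw [hDσ]
      have : D * D ^ (σ - 1) ≤ D * (2 * r ^ (σ - 1)) := by gcongr
      nlinarith
    -- Otherwise the segment stays at distance at least r / 2 from t₀, and the mean value inequality
    -- applies.
    · have e1 : ‖f x - f y‖ ≤ M * (r / 2) ^ (σ - 1) * ‖x - y‖ := by
        have hs : ∀ s ∈ Metric.ball y (r / 2), r / 2 ≤ |s - t₀| := by
          intro s hs
          rw [Metric.mem_ball, Real.dist_eq, abs_sub_comm] at hs
          have : |y - t₀| ≤ |y - s| + |s - t₀| := abs_sub_le _ _ _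
          linarith
        have hs' : ∀ s ∈ Metric.ball y (r / 2), s ≠ t₀ := by
          intro s hs1 he
          have := hs s hs1
          rw [he, sub_self, abs_zero] at this
          linarith
        refine Convex.norm_image_sub_le_of_norm_deriv_le (𝕜 := ℝ) (s := Metric.ball y (r / 2))
          (fun s hs1 => hd s (hs' s hs1)) (fun s hs1 => (hf' s (hs' s hs1)).trans ?_)
          (convex_ball _ _) (Metric.mem_ball_self (by linarith)) (by simpa [Real.dist_eq] using hcase)
        gcongr 1
        exact Real.rpow_le_rpow_of_nonpos (by linarith) (hs s hs1) (by linarith)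
      rw [Real.norm_eq_abs] at e1
      have e2 : ‖f x - f y‖ ≤ 2 * M * (D * r ^ (σ - 1)) := by
        refine e1.trans ?_
        have : M * (r / 2) ^ (σ - 1) * D ≤ M * (2 * r ^ (σ - 1)) * D := by gcongr
        linarith
      have hp : 0 ≤ D * r ^ (σ - 1) := by positivity
      refine ⟨e2.trans ?_, e2.trans (by nlinarith [mul_nonneg hM hp])⟩
      have e4 : r ^ (σ - 1) ≤ D ^ (σ - 1) :=
        Real.rpow_le_rpow_of_nonpos hD (by linarith) (by linarith)
      have e5 : D * r ^ (σ - 1) ≤ D ^ σ := by rw [hDσ]; gcongr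
      nlinarith [mul_le_mul_of_nonneg_left e5 hM, mul_nonneg hM hp]
  refine ⟨hc, h0, h1, by positivity, fun x y => ?_, fun x y hy => ?_⟩
  · rcases eq_or_ne x y with rfl | hxy
    · simp only [sub_self, norm_zero]; positivity
    · rcases eq_or_ne y t₀ with rfl | hy
      · have hy0 : f y = 0 := by
          have := hf y
          rw [sub_self, abs_zero, Real.zero_rpow h0.ne', mul_zero] at this
          exact norm_le_zero_iff.1 this
        rw [hy0, sub_zero]
        refine (hf x).trans ?_
        gcongr
        linarith
      · exact (key x y hy hxy).1
  · rcases eq_or_ne x y with rfl | hxy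
    · simp only [sub_self, norm_zero]; positivity
    · exact (key x y hy hxy).2

theorem HolderTypeCondition.exists_holderOffPoint {f : ℝ → ℂ} {n : ℕ} {t₀ γ R : ℝ} (hn : 1 ≤ n)
    (hγ : 0 < γ) (hR1 : R ≤ 1) (hf : HolderTypeCondition f n t₀ γ R) :
    ∃ σ M : ℝ, HolderOffPoint f t₀ σ M := by
  obtain ⟨M, hM⟩ := hf.bound
  have hσγ : min γ (1 / 2) ≤ γ := min_le_left _ _
  -- The cap 1/2 forces σ < 1. Lowering the exponent is harmless because f lives where |t - t₀| ≤ 1.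
  set σ := min γ (1 / 2) with hσ
  have h0 : 0 < σ := lt_min hγ (by norm_num)
  have h1 : σ < 1 := (min_le_right _ _).trans_lt (by norm_num)
  have hM0 : 0 ≤ |M| := abs_nonneg M
  have hne : ∀ t, t ≠ t₀ → 0 < |t - t₀| := fun t ht => abs_pos.2 (sub_ne_zero.2 ht)
  have b0 : ∀ t, t ≠ t₀ → ‖f t‖ ≤ |M| * |t - t₀| ^ σ := by
    intro t ht
    rcases le_or_gt R |t - t₀| with hRt | hRt
    · rw [hf.support t hRt, norm_zero]; positivity
    · have h2 := hM 0 (Nat.zero_le n) t ht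
      have hp := hne t ht
      rw [iteratedDeriv_zero, Nat.cast_zero, add_zero, Real.rpow_neg hp.le,
        mul_inv_le_iff₀ (Real.rpow_pos_of_pos hp _)] at h2
      refine h2.trans (mul_le_mul (le_abs_self M) ?_ (by positivity) hM0)
      exact Real.rpow_le_rpow_of_exponent_ge hp (by linarith) hσγ
  have h00 : f t₀ = 0 := by
    have l1 : Tendsto f (𝓝[≠] t₀) (𝓝 (f t₀)) := hf.continuous.continuousAt.tendsto.mono_left
      nhdsWithin_le_nhds
    have l2 : Tendsto (fun t => |M| * |t - t₀| ^ σ) (𝓝[≠] t₀) (𝓝 0) := by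
      have : Continuous fun t : ℝ => |M| * |t - t₀| ^ σ := by
        refine continuous_const.mul (Continuous.rpow_const (by fun_prop) (fun _ => Or.inr h0.le))
      have h3 := this.tendsto t₀
      rw [sub_self, abs_zero, Real.zero_rpow h0.ne', mul_zero] at h3
      exact h3.mono_left nhdsWithin_le_nhds
    refine tendsto_nhds_unique l1 (squeeze_zero_norm' ?_ l2)
    filter_upwards [self_mem_nhdsWithin] with t ht using b0 t ht
  have hdiff : ∀ t, t ≠ t₀ → DifferentiableAt ℝ f t := fun t ht =>
    (hf.contDiffOn.differentiableOn (by exact_mod_cast (by omega : n ≠ 0))).differentiableAt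
      (isOpen_compl_singleton.mem_nhds ht)
  refine ⟨σ, _, holderOffPoint_of_growth hf.continuous h0 h1 hM0 (fun t => ?_) hdiff
    fun t ht => ?_⟩
  · rcases eq_or_ne t t₀ with rfl | ht
    · rw [h00, norm_zero]; positivity
    · exact b0 t ht
  · have hp := hne t ht
    rcases lt_or_ge 1 |t - t₀| with hRt | hRt
    · have : f =ᶠ[𝓝 t] fun _ => 0 := by
        have ho : IsOpen {s : ℝ | 1 < |s - t₀|} := isOpen_lt (by fun_prop) (by fun_prop)
        filter_upwards [ho.mem_nhds hRt] with s hs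
        exact hf.support s (hR1.trans hs.le)
      rw [this.deriv_eq, deriv_const, norm_zero]; positivity
    · have h2 := hM 1 hn t ht
      rw [iteratedDeriv_one, Nat.cast_one, show -γ + (1 : ℝ) = -(γ - 1) by ring,
        Real.rpow_neg hp.le, mul_inv_le_iff₀ (Real.rpow_pos_of_pos hp _)] at h2
      refine h2.trans (mul_le_mul (le_abs_self M) ?_ (by positivity) hM0)
      exact Real.rpow_le_rpow_of_exponent_ge hp hRt (by linarith)

namespace HolderOffPoint

variable {f : ℝ → ℂ} {t₀ σ M : ℝ}

/-- Passing to `ENNReal` removes the exception y = t₀: there the negative power is ⊤, so the bound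
can be integrated without excluding a set. -/
theorem enorm_sub_le (hf : HolderOffPoint f t₀ σ M) (x y : ℝ) :
    ‖f x - f y‖ₑ ≤ ENNReal.ofReal (M * |x - y|) * ENNReal.ofReal |y - t₀| ^ (σ - 1) := by
  have hneg : σ - 1 < 0 := by linarith [hf.exponent_lt]
  rw [← ofReal_norm]
  rcases eq_or_ne y t₀ with rfl | hy
  · rw [sub_self, abs_zero, ENNReal.ofReal_zero, ENNReal.zero_rpow_of_neg hneg]
    have h1 := hf.holder x y
    rcases (mul_nonneg hf.const_nonneg (abs_nonneg (x - y))).eq_or_lt with h0 | h0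
    · have : M * |x - y| ^ σ = 0 := by
        rcases mul_eq_zero.1 h0.symm with h | h
        · rw [h, zero_mul]
        · rw [h, Real.zero_rpow hf.exponent_pos.ne', mul_zero]
      rw [this] at h1
      rw [ENNReal.ofReal_of_nonpos h1]
      exact zero_le
    · rw [ENNReal.mul_top (by simpa using h0)]
      exact le_top
  · rw [ENNReal.ofReal_rpow_of_pos (abs_pos.2 (sub_ne_zero.2 hy)),
      ← ENNReal.ofReal_mul (mul_nonneg hf.const_nonneg (abs_nonneg _)), mul_assoc]
    exact ENNReal.ofReal_le_ofReal (hf.lipschitz x y hy)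

end HolderOffPoint

/-! ### Hölder estimates for U -/

theorem intervalIntegrable_mul_one_sub_rpow {p : ℝ} (hp : 0 < p) :
    IntervalIntegrable (fun t : ℝ => (t * (1 - t)) ^ (p - 1)) volume 0 1 := by
  have h := (Complex.betaIntegral_convergent (u := (p : ℂ)) (v := (p : ℂ)) (by simpa) (by simpa)).norm
  refine h.congr_ae ?_
  rw [Set.uIoc_of_le zero_le_one, ← restrict_Ioo_eq_restrict_Ioc]
  filter_upwards [ae_restrict_mem measurableSet_Ioo] with t ht
  have h1 : 0 < 1 - t := by linarith [ht.2]
  rw [norm_mul, show (1 : ℂ) - (t : ℂ) = ((1 - t : ℝ) : ℂ) by push_cast; ring,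
    Complex.norm_cpow_eq_rpow_re_of_pos ht.1, Complex.norm_cpow_eq_rpow_re_of_pos h1,
    Real.mul_rpow ht.1.le h1.le]
  simp

/-- The Euler beta integral `B(p, p)`. -/
noncomputable def betaDiag (p : ℝ) : ℝ := ∫ t in (0 : ℝ)..1, (t * (1 - t)) ^ (p - 1)

theorem betaDiag_nonneg (p : ℝ) : 0 ≤ betaDiag p :=
  intervalIntegral.integral_nonneg zero_le_one fun t ht =>
    Real.rpow_nonneg (mul_nonneg ht.1 (by linarith [ht.2])) _

theorem lintegral_mul_one_sub_rpow {p : ℝ} (hp : 0 < p) :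
    ∫⁻ t in Set.Ioc (0 : ℝ) 1, ENNReal.ofReal ((t * (1 - t)) ^ (p - 1)) =
      ENNReal.ofReal (betaDiag p) := by
  rw [betaDiag, intervalIntegral.integral_of_le zero_le_one]
  refine (ofReal_integral_eq_lintegral_ofReal
    ((intervalIntegrable_iff_integrableOn_Ioc_of_le zero_le_one).1
      (intervalIntegrable_mul_one_sub_rpow hp)) ?_).symm
  filter_upwards [ae_restrict_mem measurableSet_Ioc] with t ht
  exact Real.rpow_nonneg (mul_nonneg ht.1.le (by linarith [ht.2])) _

theorem one_sub_mul_rpow_le {σ t : ℝ} (h1 : σ < 1) (ht0 : 0 ≤ t) (ht1 : t ≤ 1) :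
    (1 - t) * t ^ σ ≤ (t * (1 - t)) ^ σ := by
  have h : 0 ≤ 1 - t := by linarith
  rw [Real.mul_rpow ht0 h, mul_comm]
  gcongr
  rcases h.eq_or_lt with h0 | h0
  · rw [← h0]; exact Real.rpow_nonneg le_rfl _
  · calc 1 - t = (1 - t) ^ (1 : ℝ) := (Real.rpow_one _).symm
      _ ≤ (1 - t) ^ σ := Real.rpow_le_rpow_of_exponent_ge h0 (by linarith) h1.le

theorem measurable_widomUIntegrand {f : ℝ → ℂ} (hf : Continuous f) :
    Measurable fun q : (ℝ × ℝ) × ℝ => widomUIntegrand q.1.1 q.1.2 f q.2 := by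
  have := hf.measurable
  unfold widomUIntegrand
  fun_prop

theorem measurable_widomU {f : ℝ → ℂ} (hf : Continuous f) :
    Measurable fun p : ℝ × ℝ => widomU p.1 p.2 f := by
  simp only [widomU, intervalIntegral.integral_of_le zero_le_one]
  exact (StronglyMeasurable.integral_prod_right (f := fun (p : ℝ × ℝ) (t : ℝ) =>
    widomUIntegrand p.1 p.2 f t)
    (measurable_widomUIntegrand hf).stronglyMeasurable).measurable

theorem widomU_comm (s₁ s₂ : ℝ) (f : ℝ → ℂ) : widomU s₁ s₂ f = widomU s₂ s₁ f := by
  have h := intervalIntegral.integral_comp_sub_left (a := 0) (b := 1)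
    (fun t => widomUIntegrand s₁ s₂ f t) 1
  rw [sub_self, sub_zero] at h
  rw [widomU, ← h, widomU]
  congr 1
  ext t
  simp only [widomUIntegrand]
  push_cast
  rw [show (1 - (1 - t)) * s₁ + (1 - t) * s₂ = (1 - t) * s₂ + t * s₁ by ring]
  congr 1 <;> ring

theorem widomU_self (s : ℝ) (f : ℝ → ℂ) : widomU s s f = 0 := by
  have : widomUIntegrand s s f = fun _ => 0 := by
    ext t
    rw [widomUIntegrand, show (1 - t) * s + t * s = s by ring]
    rw [show f s - ((1 - (t : ℂ)) * f s + t * f s) = 0 by ring, zero_div]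
  rw [widomU, this]; simp

namespace HolderOffPoint

variable {f : ℝ → ℂ} {t₀ σ M : ℝ}

/-- The numerator is the convex combination of f x - f s₁ and f x - f s₂ with weights 1 - t and t,
while x lies at distance t|s₁ - s₂| and (1 - t)|s₁ - s₂| from the two ends. The resulting factor
(t(1-t))^σ tames the denominator t(1-t). -/
theorem norm_sub_interpolation_le (hf : HolderOffPoint f t₀ σ M) (s₁ s₂ : ℝ) {t : ℝ}
    (ht : t ∈ Set.Icc (0 : ℝ) 1) :
    ‖f ((1 - t) * s₁ + t * s₂) - ((1 - (t : ℂ)) * f s₁ + t * f s₂)‖ ≤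
      2 * M * ((t * (1 - t)) ^ σ * |s₁ - s₂| ^ σ) := by
  obtain ⟨ht0, ht1⟩ := ht
  have h1t : 0 ≤ 1 - t := by linarith
  have hM := hf.const_nonneg
  set x := (1 - t) * s₁ + t * s₂ with hx
  have e1 : ‖f x - f s₁‖ ≤ M * (t ^ σ * |s₁ - s₂| ^ σ) := by
    have := hf.holder x s₁
    rwa [show x - s₁ = t * (s₂ - s₁) by rw [hx]; ring, abs_mul, abs_of_nonneg ht0,
      abs_sub_comm s₂, Real.mul_rpow ht0 (abs_nonneg _)] at this
  have e2 : ‖f x - f s₂‖ ≤ M * ((1 - t) ^ σ * |s₁ - s₂| ^ σ) := by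
    have := hf.holder x s₂
    rwa [show x - s₂ = (1 - t) * (s₁ - s₂) by rw [hx]; ring, abs_mul, abs_of_nonneg h1t,
      Real.mul_rpow h1t (abs_nonneg _)] at this
  have hd : 0 ≤ |s₁ - s₂| ^ σ := by positivity
  have w1 := one_sub_mul_rpow_le hf.exponent_lt ht0 ht1
  have w2 := one_sub_mul_rpow_le hf.exponent_lt h1t (by linarith : 1 - t ≤ 1)
  rw [sub_sub_cancel, mul_comm (1 - t) t] at w2
  have e3 : f x - ((1 - (t : ℂ)) * f s₁ + t * f s₂) =
      ((1 - t : ℝ) : ℂ) * (f x - f s₁) + (t : ℂ) * (f x - f s₂) := by push_cast; ring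
  rw [e3]
  refine (norm_add_le _ _).trans ?_
  rw [norm_mul, norm_mul, Complex.norm_real, Complex.norm_real, Real.norm_of_nonneg h1t,
    Real.norm_of_nonneg ht0]
  have b1 : (1 - t) * ‖f x - f s₁‖ ≤ M * |s₁ - s₂| ^ σ * ((1 - t) * t ^ σ) := by
    have := mul_le_mul_of_nonneg_left e1 h1t; linarith
  have b2 : t * ‖f x - f s₂‖ ≤ M * |s₁ - s₂| ^ σ * (t * (1 - t) ^ σ) := by
    have := mul_le_mul_of_nonneg_left e2 ht0; linarith
  have c1 := mul_le_mul_of_nonneg_left w1 (mul_nonneg hM hd)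
  have c2 := mul_le_mul_of_nonneg_left w2 (mul_nonneg hM hd)
  linarith

theorem norm_widomUIntegrand_le (hf : HolderOffPoint f t₀ σ M) (s₁ s₂ : ℝ) {t : ℝ}
    (ht : t ∈ Set.Icc (0 : ℝ) 1) :
    ‖widomUIntegrand s₁ s₂ f t‖ ≤ 2 * M * |s₁ - s₂| ^ σ * (t * (1 - t)) ^ (σ - 1) := by
  have hp : 0 ≤ t * (1 - t) := mul_nonneg ht.1 (by linarith [ht.2])
  have hM := hf.const_nonneg
  rw [widomUIntegrand, norm_div, show (t : ℂ) * (1 - t) = ((t * (1 - t) : ℝ) : ℂ) by push_cast; ring,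
    Complex.norm_real, Real.norm_of_nonneg hp]
  rcases hp.eq_or_lt with h0 | h0
  -- At an endpoint the integrand is 0 by the convention for division by zero.
  · rw [← h0, div_zero]; positivity
  · rw [div_le_iff₀ h0, mul_assoc, Real.rpow_sub_one h0.ne', div_mul_cancel₀ _ h0.ne']
    have := hf.norm_sub_interpolation_le s₁ s₂ ht
    linarith

theorem intervalIntegrable_widomUIntegrand (hf : HolderOffPoint f t₀ σ M) (s₁ s₂ : ℝ) :
    IntervalIntegrable (widomUIntegrand s₁ s₂ f) volume 0 1 := by
  refine ((intervalIntegrable_mul_one_sub_rpow hf.exponent_pos).const_mul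
    (2 * M * |s₁ - s₂| ^ σ)).mono_fun' ?_ ?_
  · exact ((measurable_widomUIntegrand hf.continuous).comp
      (measurable_const (a := (s₁, s₂)) |>.prodMk measurable_id)).aestronglyMeasurable
  · rw [Set.uIoc_of_le zero_le_one]
    filter_upwards [ae_restrict_mem measurableSet_Ioc] with t ht
    exact hf.norm_widomUIntegrand_le s₁ s₂ ⟨ht.1.le, ht.2⟩

theorem norm_widomU_le (hf : HolderOffPoint f t₀ σ M) (s₁ s₂ : ℝ) :
    ‖widomU s₁ s₂ f‖ ≤ 2 * M * betaDiag σ * |s₁ - s₂| ^ σ := by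
  have := intervalIntegral.norm_integral_le_of_norm_le (μ := volume) zero_le_one
    (ae_of_all _ fun t (ht : t ∈ Set.Ioc (0 : ℝ) 1) =>
      hf.norm_widomUIntegrand_le s₁ s₂ ⟨ht.1.le, ht.2⟩)
    ((intervalIntegrable_mul_one_sub_rpow hf.exponent_pos).const_mul (2 * M * |s₁ - s₂| ^ σ))
  rw [intervalIntegral.integral_const_mul] at this
  rw [widomU]
  refine this.trans_eq ?_
  rw [betaDiag]; ring

/-- The difference of numerators has two bounds: one small at the endpoints t = 0, 1, the other
small when the arguments are close. Their geometric mean has both virtues, at the price of halving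
σ. -/
theorem norm_widomUIntegrand_sub_le (hf : HolderOffPoint f t₀ σ M) {s₁ s₂ u₁ u₂ : ℝ}
    (hs : |s₁ - s₂| ≤ 1) (hu : |u₁ - u₂| ≤ 1) {t : ℝ} (ht : t ∈ Set.Icc (0 : ℝ) 1) :
    ‖widomUIntegrand s₁ s₂ f t - widomUIntegrand u₁ u₂ f t‖ ≤
      3 * M * (|s₁ - u₁| ^ (σ / 2) + |s₂ - u₂| ^ (σ / 2)) * (t * (1 - t)) ^ (σ / 2 - 1) := by
  have hp : 0 ≤ t * (1 - t) := mul_nonneg ht.1 (by linarith [ht.2])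
  have h1t : 0 ≤ 1 - t := by linarith [ht.2]
  have hM := hf.const_nonneg
  have h0 := hf.exponent_pos
  have n1 := hf.norm_sub_interpolation_le s₁ s₂ ht
  have n2 := hf.norm_sub_interpolation_le u₁ u₂ ht
  rw [widomUIntegrand, widomUIntegrand, ← sub_div, norm_div,
    show (t : ℂ) * (1 - t) = ((t * (1 - t) : ℝ) : ℂ) by push_cast; ring,
    Complex.norm_real, Real.norm_of_nonneg hp]
  set x := (1 - t) * s₁ + t * s₂ with hx
  set y := (1 - t) * u₁ + t * u₂ with hy
  set N₁ := f x - ((1 - (t : ℂ)) * f s₁ + t * f s₂) with hN₁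
  set N₂ := f y - ((1 - (t : ℂ)) * f u₁ + t * f u₂) with hN₂
  rcases hp.eq_or_lt with h00 | h00
  · rw [← h00, div_zero]; positivity
  rw [div_le_iff₀ h00, mul_assoc, Real.rpow_sub_one h00.ne', div_mul_cancel₀ _ h00.ne']
  have sq : ∀ r : ℝ, 0 ≤ r → r ^ σ = (r ^ (σ / 2)) ^ 2 := by
    intro r hr
    rw [← Real.rpow_natCast, ← Real.rpow_mul hr]; congr 1; push_cast; ring
  have a1 : ‖N₁ - N₂‖ ≤ 4 * M * (t * (1 - t)) ^ σ := by
    refine (norm_sub_le _ _).trans ?_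
    have hq : 0 ≤ (t * (1 - t)) ^ σ := by positivity
    have g1 : (t * (1 - t)) ^ σ * |s₁ - s₂| ^ σ ≤ (t * (1 - t)) ^ σ * 1 := by
      gcongr; exact Real.rpow_le_one (abs_nonneg _) hs h0.le
    have g2 : (t * (1 - t)) ^ σ * |u₁ - u₂| ^ σ ≤ (t * (1 - t)) ^ σ * 1 := by
      gcongr; exact Real.rpow_le_one (abs_nonneg _) hu h0.le
    have g3 := mul_le_mul_of_nonneg_left g1 hM
    have g4 := mul_le_mul_of_nonneg_left g2 hM
    linarith
  have a2 : ‖N₁ - N₂‖ ≤ 2 * M * (|s₁ - u₁| ^ σ + |s₂ - u₂| ^ σ) := by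
    have e : N₁ - N₂ = (f x - f y) - (((1 - t : ℝ) : ℂ) * (f s₁ - f u₁) + (t : ℂ) * (f s₂ - f u₂)) := by
      rw [hN₁, hN₂]; push_cast; ring
    have b0 : ‖f x - f y‖ ≤ M * (|s₁ - u₁| ^ σ + |s₂ - u₂| ^ σ) := by
      refine (hf.holder x y).trans ?_
      gcongr
      have : |x - y| ≤ |s₁ - u₁| + |s₂ - u₂| := by
        rw [show x - y = (1 - t) * (s₁ - u₁) + t * (s₂ - u₂) by rw [hx, hy]; ring]
        refine (abs_add_le _ _).trans ?_
        rw [abs_mul, abs_mul, abs_of_nonneg h1t, abs_of_nonneg ht.1]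
        have := mul_le_mul_of_nonneg_right ht.2 (abs_nonneg (s₂ - u₂))
        have := mul_nonneg ht.1 (abs_nonneg (s₁ - u₁))
        linarith
      exact (Real.rpow_le_rpow (abs_nonneg _) this h0.le).trans
        (Real.rpow_add_le_add_rpow (abs_nonneg _) (abs_nonneg _) h0.le hf.exponent_lt.le)
    have b1 := hf.holder s₁ u₁
    have b2 := hf.holder s₂ u₂
    rw [e]
    refine (norm_sub_le _ _).trans ?_
    have b3 := norm_add_le (((1 - t : ℝ) : ℂ) * (f s₁ - f u₁)) ((t : ℂ) * (f s₂ - f u₂))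
    rw [norm_mul, norm_mul, Complex.norm_real, Complex.norm_real, Real.norm_of_nonneg h1t,
      Real.norm_of_nonneg ht.1] at b3
    have b4 := mul_le_mul_of_nonneg_right ht.2 (norm_nonneg (f s₂ - f u₂))
    have b5 := mul_nonneg ht.1 (norm_nonneg (f s₁ - f u₁))
    linarith
  -- Squared, the claim follows from the product of the two bounds: 4 · 2 (X² + Y²) ≤ 3² (X + Y)²,
  -- the excess being the term in `p4`.
  rw [← sq_le_sq₀ (norm_nonneg _) (by positivity)]
  rw [sq _ hp] at a1
  rw [sq _ (abs_nonneg _), sq _ (abs_nonneg _)] at a2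
  have a3 := mul_le_mul a1 a2 (norm_nonneg _) (by positivity)
  have p1 : 0 ≤ |s₁ - u₁| ^ (σ / 2) := by positivity
  have p2 : 0 ≤ |s₂ - u₂| ^ (σ / 2) := by positivity
  have p3 : 0 ≤ (t * (1 - t)) ^ (σ / 2) := by positivity
  generalize |s₁ - u₁| ^ (σ / 2) = X at *
  generalize |s₂ - u₂| ^ (σ / 2) = Y at *
  generalize (t * (1 - t)) ^ (σ / 2) = W at *
  have p4 : 0 ≤ M ^ 2 * W ^ 2 * (X ^ 2 + Y ^ 2 + 18 * (X * Y)) := by positivity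
  nlinarith

theorem norm_widomU_sub_le (hf : HolderOffPoint f t₀ σ M) {s₁ s₂ u₁ u₂ : ℝ}
    (hs : |s₁ - s₂| ≤ 1) (hu : |u₁ - u₂| ≤ 1) :
    ‖widomU s₁ s₂ f - widomU u₁ u₂ f‖ ≤
      3 * M * betaDiag (σ / 2) * (|s₁ - u₁| ^ (σ / 2) + |s₂ - u₂| ^ (σ / 2)) := by
  rw [widomU, widomU, ← intervalIntegral.integral_sub
    (hf.intervalIntegrable_widomUIntegrand s₁ s₂) (hf.intervalIntegrable_widomUIntegrand u₁ u₂)]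
  have := intervalIntegral.norm_integral_le_of_norm_le (μ := volume) zero_le_one
    (ae_of_all _ fun t (ht : t ∈ Set.Ioc (0 : ℝ) 1) =>
      hf.norm_widomUIntegrand_sub_le hs hu ⟨ht.1.le, ht.2⟩)
    ((intervalIntegrable_mul_one_sub_rpow (half_pos hf.exponent_pos)).const_mul
      (3 * M * (|s₁ - u₁| ^ (σ / 2) + |s₂ - u₂| ^ (σ / 2))))
  rw [intervalIntegral.integral_const_mul] at this
  refine this.trans_eq ?_
  rw [betaDiag]; ring

end HolderOffPoint

/-! ### The Fermi function and its singular weight -/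

/-- The Fermi function `x ↦ 1 / (1 + exp x)`. -/
noncomputable def fermiFun (x : ℝ) : ℝ := 1 / (1 + Real.exp x)

/-- Minus the derivative of the Fermi function. -/
noncomputable def fermiWidth (x : ℝ) : ℝ := 1 / (2 + Real.exp x + Real.exp (-x))

theorem fermiFun_pos (x : ℝ) : 0 < fermiFun x := by unfold fermiFun; positivity

theorem one_sub_fermiFun (x : ℝ) : 1 - fermiFun x = fermiFun (-x) := by
  have := Real.exp_pos x
  unfold fermiFun
  rw [Real.exp_neg]
  field_simp
  ring

theorem fermiFun_lt_one (x : ℝ) : fermiFun x < 1 := by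
  linarith [fermiFun_pos (-x), one_sub_fermiFun x]

theorem fermiWidth_pos (x : ℝ) : 0 < fermiWidth x := by unfold fermiWidth; positivity

theorem fermiWidth_eq (x : ℝ) : fermiWidth x = fermiFun x * fermiFun (-x) := by
  have := Real.exp_pos x
  unfold fermiWidth fermiFun
  rw [Real.exp_neg]
  field_simp
  ring

theorem fermiFun_le_exp (x : ℝ) : fermiFun x ≤ Real.exp (-x) := by
  have := Real.exp_pos x
  unfold fermiFun
  rw [Real.exp_neg, ← one_div]
  gcongr
  linarith

theorem fermiWidth_le_fermiFun (x : ℝ) : fermiWidth x ≤ fermiFun x := by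
  rw [fermiWidth_eq]
  nlinarith [fermiFun_pos x, fermiFun_lt_one (-x)]

theorem fermiWidth_neg (x : ℝ) : fermiWidth (-x) = fermiWidth x := by
  rw [fermiWidth_eq, fermiWidth_eq, neg_neg, mul_comm]

theorem fermiWidth_le_exp (x : ℝ) : fermiWidth x ≤ Real.exp (-|x|) := by
  rcases abs_choice x with h | h <;> rw [h]
  · exact (fermiWidth_le_fermiFun x).trans (fermiFun_le_exp x)
  · rw [← fermiWidth_neg]
    exact (fermiWidth_le_fermiFun _).trans (fermiFun_le_exp _)

/-- Every term of the denominator changes by at most the factor exp |x - y|. This lets the width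
along a short interval be replaced by its value at one point. -/
theorem fermiWidth_le_exp_abs_sub_mul (x y : ℝ) :
    fermiWidth y ≤ Real.exp |x - y| * fermiWidth x := by
  unfold fermiWidth
  have h1 : Real.exp x ≤ Real.exp |x - y| * Real.exp y := by
    rw [← Real.exp_add]; gcongr; linarith [le_abs_self (x - y)]
  have h2 : Real.exp (-x) ≤ Real.exp |x - y| * Real.exp (-y) := by
    rw [← Real.exp_add]; gcongr; linarith [neg_abs_le (x - y)]
  have h3 : 1 ≤ Real.exp |x - y| := Real.one_le_exp (abs_nonneg _)
  rw [mul_one_div, div_le_div_iff₀ (by positivity) (by positivity)]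
  linarith

theorem hasDerivAt_fermiFun (x : ℝ) : HasDerivAt fermiFun (-fermiWidth x) x := by
  have h := ((Real.hasDerivAt_exp x).const_add 1).inv (by positivity)
  have e : fermiFun = fun y => (1 + Real.exp y)⁻¹ := by ext y; simp [fermiFun]
  rw [e]
  refine h.congr_deriv ?_
  have := Real.exp_pos x
  unfold fermiWidth
  rw [Real.exp_neg]
  field_simp
  ring

theorem hasDerivAt_fermiWidth (x : ℝ) :
    HasDerivAt fermiWidth (-(fermiWidth x * (1 - 2 * fermiFun x))) x := by
  have e : fermiWidth = fun y => fermiFun y * (1 - fermiFun y) := by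
    ext y; rw [fermiWidth_eq, one_sub_fermiFun]
  have h := (hasDerivAt_fermiFun x).mul ((hasDerivAt_fermiFun x).const_sub 1)
  rw [e] at h ⊢
  refine h.congr_deriv ?_
  ring

theorem abs_one_sub_two_mul_fermiFun_le (x : ℝ) : |1 - 2 * fermiFun x| ≤ 1 := by
  rw [abs_le]; constructor <;> linarith [fermiFun_pos x, fermiFun_lt_one x]

theorem abs_fermiFun_sub_indicator_le (x : ℝ) :
    |fermiFun x - (Set.Iio (0 : ℝ)).indicator 1 x| ≤ Real.exp (-|x|) := by
  rcases lt_or_ge x 0 with hx | hx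
  · rw [Set.indicator_of_mem (by exact hx), Pi.one_apply, abs_sub_comm, one_sub_fermiFun,
      abs_of_pos (fermiFun_pos _), abs_of_neg hx]
    exact fermiFun_le_exp _
  · rw [Set.indicator_of_notMem (by simpa using hx), sub_zero, abs_of_pos (fermiFun_pos _),
      abs_of_nonneg hx]
    exact fermiFun_le_exp _

theorem fermiFun_strictAnti : StrictAnti fermiFun := by
  intro x y hxy
  unfold fermiFun
  gcongr

theorem continuous_fermiFun : Continuous fermiFun :=
  continuous_iff_continuousAt.2 fun x => (hasDerivAt_fermiFun x).continuousAt

theorem continuous_fermiWidth : Continuous fermiWidth :=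
  continuous_iff_continuousAt.2 fun x => (hasDerivAt_fermiWidth x).continuousAt

theorem lintegral_abs_sub_rpow_lt_top {r : ℝ} (hr : -1 < r) (t₀ : ℝ) (K : ℝ) :
    ∫⁻ s in Set.Icc (t₀ - K) (t₀ + K), ENNReal.ofReal |s - t₀| ^ r < ⊤ := by
  rcases lt_or_ge K 0 with hK | hK
  · rw [Set.Icc_eq_empty (by linarith)]; simp
  have base : ∫⁻ s in Set.Ioc 0 K, ENNReal.ofReal s ^ r < ⊤ := by
    have h1 := (intervalIntegral.intervalIntegrable_rpow' (a := 0) (b := K) hr)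
    rw [intervalIntegrable_iff_integrableOn_Ioc_of_le hK] at h1
    have h2 := h1.lintegral_lt_top
    refine (setLIntegral_congr_fun measurableSet_Ioc fun s hs => ?_).trans_lt h2
    exact ENNReal.ofReal_rpow_of_pos hs.1
  have hm : Measurable fun s : ℝ => ENNReal.ofReal s ^ r := by fun_prop
  have R : ∫⁻ s in Set.Ioc t₀ (t₀ + K), ENNReal.ofReal |s - t₀| ^ r < ⊤ := by
    rw [← lintegral_indicator measurableSet_Ioc] at base ⊢
    rw [← lintegral_sub_right_eq_self _ t₀] at base
    refine (lintegral_congr fun s => ?_).trans_lt base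
    by_cases hs : s ∈ Set.Ioc t₀ (t₀ + K)
    · rw [Set.indicator_of_mem hs, Set.indicator_of_mem
        (by constructor <;> linarith [hs.1, hs.2]), abs_of_pos (by linarith [hs.1])]
    · rw [Set.indicator_of_notMem hs, Set.indicator_of_notMem]
      intro h; exact hs ⟨by linarith [h.1], by linarith [h.2]⟩
  have Lf : ∫⁻ s in Set.Ico (t₀ - K) t₀, ENNReal.ofReal |s - t₀| ^ r < ⊤ := by
    rw [← lintegral_indicator measurableSet_Ico]
    rw [← lintegral_indicator measurableSet_Ioc, ← lintegral_sub_left_eq_self _ t₀] at base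
    refine (lintegral_congr fun s => ?_).trans_lt base
    by_cases hs : s ∈ Set.Ico (t₀ - K) t₀
    · rw [Set.indicator_of_mem hs, Set.indicator_of_mem
        (by constructor <;> linarith [hs.1, hs.2]), abs_of_neg (by linarith [hs.2]), neg_sub]
    · rw [Set.indicator_of_notMem hs, Set.indicator_of_notMem]
      intro h; exact hs ⟨by linarith [h.2], by linarith [h.1]⟩
  have hsub : Set.Icc (t₀ - K) (t₀ + K) ⊆ Set.Ico (t₀ - K) t₀ ∪ ({t₀} ∪ Set.Ioc t₀ (t₀ + K)) := by
    intro s hs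
    rcases lt_trichotomy s t₀ with h | h | h
    · exact Or.inl ⟨hs.1, h⟩
    · exact Or.inr (Or.inl h)
    · exact Or.inr (Or.inr ⟨h, hs.2⟩)
  refine (lintegral_mono_set hsub).trans_lt ?_
  refine (lintegral_union_le _ _ _).trans_lt (ENNReal.add_lt_top.2 ⟨Lf, ?_⟩)
  refine (lintegral_union_le _ _ _).trans_lt (ENNReal.add_lt_top.2 ⟨?_, R⟩)
  simp [Measure.restrict_singleton]

/-- The weight `-φ' |φ - t₀| ^ (σ - 1)`, `φ` being the Fermi function. -/
noncomputable def fermiSingularWeight (t₀ σ x : ℝ) : ENNReal :=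
  ENNReal.ofReal (fermiWidth x) * ENNReal.ofReal |fermiFun x - t₀| ^ (σ - 1)

theorem measurable_fermiSingularWeight (t₀ σ : ℝ) : Measurable (fermiSingularWeight t₀ σ) := by
  have h1 := continuous_fermiFun.measurable
  have h2 := continuous_fermiWidth.measurable
  unfold fermiSingularWeight
  fun_prop

/-- Since the width is minus the derivative of the Fermi function, the substitution s = φ(x) turns
the integral into that of |s - t₀|^(σ-1) over a bounded set, finite because σ > 0. -/
theorem lintegral_fermiSingularWeight_lt_top {σ : ℝ} (hσ : 0 < σ) (t₀ : ℝ) :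
    ∫⁻ x, fermiSingularWeight t₀ σ x < ⊤ := by
  have h := lintegral_image_eq_lintegral_abs_deriv_mul MeasurableSet.univ
    (fun x _ => (hasDerivAt_fermiFun x).hasDerivWithinAt) fermiFun_strictAnti.injective.injOn
    (fun s => ENNReal.ofReal |s - t₀| ^ (σ - 1))
  simp only [abs_neg, abs_of_pos (fermiWidth_pos _), Measure.restrict_univ] at h
  unfold fermiSingularWeight
  rw [← h]
  refine (lintegral_mono_set ?_).trans_lt
    (lintegral_abs_sub_rpow_lt_top (by linarith : -1 < σ - 1) t₀ (1 + |t₀|))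
  rintro _ ⟨x, -, rfl⟩
  have h1 := fermiFun_pos x
  have h2 := fermiFun_lt_one x
  constructor <;> linarith [le_abs_self t₀, neg_abs_le t₀]

/-- If 0 < t₀ < 1, then φ(x) stays away from t₀ for large |x|, and the width decays by itself.
Otherwise |φ - t₀| is at least the width, so the weight is at most its σ-th power; this includes t₀
= 0 and t₀ = 1, where the weight really is singular at infinity. -/
theorem exists_fermiSingularWeight_le {σ : ℝ} (hσ : 0 < σ) (hσ1 : σ < 1) (t₀ : ℝ) :
    ∃ X C : ℝ, 0 ≤ C ∧ ∀ x, X ≤ |x| →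
      fermiSingularWeight t₀ σ x ≤ ENNReal.ofReal (C * Real.exp (-σ * |x|)) := by
  have hexp : ∀ x : ℝ, fermiWidth x ^ σ ≤ Real.exp (-σ * |x|) := by
    intro x
    rw [show -σ * |x| = -|x| * σ by ring, Real.exp_mul]
    exact Real.rpow_le_rpow (fermiWidth_pos x).le (fermiWidth_le_exp x) hσ.le
  by_cases ht : 0 < t₀ ∧ t₀ < 1
  · obtain ⟨ht0, ht1⟩ := ht
    set m := min t₀ (1 - t₀) / 2 with hm
    have hmpos : 0 < m := by
      have : 0 < min t₀ (1 - t₀) := lt_min ht0 (by linarith)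
      linarith
    have hm1 : 2 * m ≤ t₀ := by
      have : min t₀ (1 - t₀) ≤ t₀ := min_le_left _ _
      linarith
    have hm2 : 2 * m ≤ 1 - t₀ := by
      have : min t₀ (1 - t₀) ≤ 1 - t₀ := min_le_right _ _
      linarith
    refine ⟨-Real.log m, m ^ (σ - 1), by positivity, fun x hx => ?_⟩
    have hxm : Real.exp (-|x|) ≤ m := by
      rw [← Real.le_log_iff_exp_le hmpos]; linarith
    have hlow : m ≤ |fermiFun x - t₀| := by
      rcases abs_choice x with h | h
      · rw [h] at hxm
        have := fermiFun_le_exp x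
        rw [abs_sub_comm]
        exact le_trans (by linarith) (le_abs_self _)
      · rw [h] at hxm
        have := fermiFun_le_exp (-x)
        rw [← one_sub_fermiFun] at this
        exact le_trans (by linarith) (le_abs_self _)
    have hpos : 0 < |fermiFun x - t₀| := hmpos.trans_le hlow
    rw [fermiSingularWeight, ENNReal.ofReal_rpow_of_pos hpos,
      ← ENNReal.ofReal_mul (fermiWidth_pos x).le]
    refine ENNReal.ofReal_le_ofReal ?_
    rw [mul_comm]
    refine mul_le_mul ?_ ?_ (fermiWidth_pos x).le (by positivity)
    · exact Real.rpow_le_rpow_of_nonpos hmpos hlow (by linarith)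
    · refine (fermiWidth_le_exp x).trans (Real.exp_le_exp.2 ?_)
      nlinarith [abs_nonneg x]
  · refine ⟨0, 1, zero_le_one, fun x _ => ?_⟩
    have hlow : fermiWidth x ≤ |fermiFun x - t₀| := by
      rcases le_or_gt t₀ 0 with h | h
      · exact ((fermiWidth_le_fermiFun x).trans (by linarith)).trans (le_abs_self _)
      · have h1 : 1 ≤ t₀ := by by_contra hc; exact ht ⟨h, not_le.1 hc⟩
        have := fermiWidth_le_fermiFun (-x)
        rw [fermiWidth_neg, ← one_sub_fermiFun] at this
        rw [abs_sub_comm]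
        exact (this.trans (by linarith)).trans (le_abs_self _)
    have hq := fermiWidth_pos x
    rw [fermiSingularWeight, ENNReal.ofReal_rpow_of_pos (hq.trans_le hlow),
      ← ENNReal.ofReal_mul hq.le]
    refine ENNReal.ofReal_le_ofReal ?_
    rw [one_mul]
    refine le_trans ?_ (hexp x)
    calc fermiWidth x * |fermiFun x - t₀| ^ (σ - 1) ≤ fermiWidth x * fermiWidth x ^ (σ - 1) := by
          gcongr 1
          exact Real.rpow_le_rpow_of_nonpos hq hlow (by linarith)
      _ = fermiWidth x ^ σ := by rw [Real.rpow_sub_one hq.ne']; field_simp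

/-! ### The dispersion relation and integrals of order T -/

/-- Quantitative form of the conditions on `v = h - μ`. -/
structure RegularDispersion (v : ℝ → ℝ) (k : ℕ) (C β κ L : ℝ) : Prop where
  contDiff : ContDiff ℝ 2 v
  const_nonneg : 0 ≤ C
  exponent_pos : 0 < β
  rate_pos : 0 < κ
  one_le : 1 ≤ L
  deriv_le : ∀ ξ, |deriv v ξ| ≤ C * (1 + |ξ|) ^ k
  deriv_deriv_le : ∀ ξ, |deriv (deriv v) ξ| ≤ C * (1 + |ξ|) ^ k
  growth : ∀ η, L ≤ |η| → ∀ ζ, |ζ - η| ≤ 1 → κ * (1 + |η|) ^ β ≤ v ζ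
  nondegenerate : ∀ ξ, v ξ = 0 → deriv v ξ ≠ 0

theorem FermiSurfaceCondition.exists_regularDispersion {h : ℝ → ℝ} {μ : ℝ}
    (hh : FermiSurfaceCondition h μ) :
    ∃ (k : ℕ) (C β κ L : ℝ), RegularDispersion (fun ξ => h ξ - μ) k C β κ L := by
  obtain ⟨β, hβ, c, hc, ρ, hg⟩ := hh.growth
  obtain ⟨β₂, hβ₂, hd⟩ := hh.deriv_bound
  obtain ⟨C₁, hC₁⟩ := hd 1 le_rfl
  obtain ⟨C₂, hC₂⟩ := hd 2 one_le_two
  have hpow : ∀ ξ : ℝ, (1 + |ξ|) ^ β₂ ≤ (1 + |ξ|) ^ ⌈β₂⌉₊ := by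
    intro ξ
    rw [← Real.rpow_natCast]
    exact Real.rpow_le_rpow_of_exponent_le (by linarith [abs_nonneg ξ]) (Nat.le_ceil _)
  have hbd : ∀ D : ℝ, D ≤ max |C₁| |C₂| → ∀ ξ : ℝ,
      D * (1 + |ξ|) ^ β₂ ≤ max |C₁| |C₂| * (1 + |ξ|) ^ ⌈β₂⌉₊ := by
    intro D hD ξ
    have : 0 ≤ max |C₁| |C₂| := (abs_nonneg _).trans (le_max_left _ _)
    have h2 : (0 : ℝ) ≤ (1 + |ξ|) ^ β₂ := by positivity
    exact mul_le_mul hD (hpow ξ) h2 this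
  have hderiv : deriv (fun ξ => h ξ - μ) = deriv h := by ext ξ; simp
  have hlim : Tendsto (fun x : ℝ => c / 2 * (x / 4) ^ β) atTop atTop :=
    ((tendsto_rpow_atTop hβ).comp (tendsto_id.atTop_div_const (by norm_num))).const_mul_atTop
      (by positivity)
  obtain ⟨L₀, hL₀⟩ := (hlim.eventually_ge_atTop μ).exists_forall_of_atTop
  -- For |η| ≥ 2, any ζ within distance 1 of η has |ζ| ≥ (1 + |η|)/4, whence the factor (1/4)^β.
  -- Half of c is given up to absorb μ, which is what L₀ ensures. Lower bounds near η, not only at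
  -- η, serve the later Taylor estimates.
  refine ⟨⌈β₂⌉₊, max |C₁| |C₂|, β, c / 2 * (1 / 4) ^ β, max (max 2 (ρ + 1)) L₀, ?_, ?_, hβ,
    by positivity, ?_, ?_, ?_, ?_, ?_⟩
  · exact (contDiff_infty.1 hh.smooth 2).sub contDiff_const
  · exact (abs_nonneg _).trans (le_max_left _ _)
  · exact le_trans (by norm_num) ((le_max_left 2 (ρ + 1)).trans (le_max_left _ L₀))
  · intro ξ
    have := hC₁ ξ
    rw [iteratedDeriv_one] at this
    rw [hderiv]
    exact this.trans (hbd _ ((le_abs_self _).trans (le_max_left _ _)) ξ)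
  · intro ξ
    have := hC₂ ξ
    rw [iteratedDeriv_succ, iteratedDeriv_one] at this
    rw [hderiv]
    exact this.trans (hbd _ ((le_abs_self _).trans (le_max_right _ _)) ξ)
  · intro η hη ζ hζ
    have h1 : 2 ≤ |η| := ((le_max_left 2 (ρ + 1)).trans (le_max_left _ L₀)).trans hη
    have h2 : ρ + 1 ≤ |η| := ((le_max_right 2 (ρ + 1)).trans (le_max_left _ L₀)).trans hη
    have h3 : L₀ ≤ |η| := (le_max_right _ L₀).trans hη
    have h4 : |η| ≤ |ζ| + 1 := by
      have : |η| ≤ |η - ζ| + |ζ| := by simpa using abs_add_le (η - ζ) ζ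
      rw [abs_sub_comm] at this
      linarith
    have h5 := hg ζ (by linarith)
    have h6 := hL₀ (1 + |η|) (by linarith)
    have h7 : ((1 + |η|) / 4) ^ β ≤ |ζ| ^ β :=
      Real.rpow_le_rpow (by positivity) (by linarith) hβ.le
    have h8 : c / 2 * (1 / 4) ^ β * (1 + |η|) ^ β = c / 2 * ((1 + |η|) / 4) ^ β := by
      rw [mul_assoc, ← Real.mul_rpow (by norm_num) (by positivity)]
      ring_nf
    rw [h8]
    have h9 := mul_le_mul_of_nonneg_left h7 hc.le
    linarith
  · intro ξ hξ
    rw [hderiv]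
    exact hh.nondegenerate ξ (by linarith)

theorem exists_rpow_mul_exp_neg_le {s b : ℝ} (hs : 0 ≤ s) (hb : 0 < b) :
    ∃ B : ℝ, ∀ u : ℝ, 0 ≤ u → u ^ s * Real.exp (-b * u) ≤ B := by
  obtain ⟨u₀, hu₀⟩ := ((tendsto_rpow_mul_exp_neg_mul_atTop_nhds_zero s b hb).eventually_le_const
    zero_lt_one).exists_forall_of_atTop
  refine ⟨max 1 (|u₀| ^ s), fun u hu => ?_⟩
  rcases le_or_gt u₀ u with h | h
  · exact (hu₀ u h).trans (le_max_left _ _)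
  · refine le_trans ?_ (le_max_right _ _)
    calc u ^ s * Real.exp (-b * u) ≤ |u₀| ^ s * 1 := by
          gcongr
          · exact h.le.trans (le_abs_self _)
          · exact Real.exp_le_one_iff.2 (by nlinarith)
      _ = |u₀| ^ s := mul_one _

theorem exists_lintegral_pow_mul_exp_neg_div_le {β κ : ℝ} (hβ : 0 < β) (hκ : 0 < κ) (m : ℕ) :
    ∃ C : ℝ, 0 ≤ C ∧ ∀ T : ℝ, 0 < T → T ≤ 1 →
      ∫⁻ η : ℝ, ENNReal.ofReal ((1 + |η|) ^ m * Real.exp (-κ * (1 + |η|) ^ β / T)) ≤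
        ENNReal.ofReal (C * T) := by
  -- At u = (1 + |η|)^β the power u^s is (1 + |η|)^(m+2): the two extra powers leave the integrable
  -- majorant (1 + |η|)^(-2).
  obtain ⟨B, hB⟩ := exists_rpow_mul_exp_neg_le (s := ((m : ℝ) + 2) / β) (b := κ / 2)
    (by positivity) (by positivity)
  have hB0 : 0 ≤ B := le_trans (by positivity) (hB 1 zero_le_one)
  have hint : Integrable (fun η : ℝ => (1 + ‖η‖) ^ (-(2 : ℝ))) :=
    integrable_one_add_norm (by simp)
  refine ⟨2 / κ * B * ∫ η : ℝ, (1 + ‖η‖) ^ (-(2 : ℝ)), by positivity, fun T hT hT1 => ?_⟩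
  have hpt : ∀ η : ℝ, (1 + |η|) ^ m * Real.exp (-κ * (1 + |η|) ^ β / T) ≤
      2 / κ * B * T * (1 + ‖η‖) ^ (-(2 : ℝ)) := by
    intro η
    rw [Real.norm_eq_abs]
    have hw : 1 ≤ 1 + |η| := by linarith [abs_nonneg η]
    set w := 1 + |η| with hw_def
    have hw0 : 0 < w := by linarith
    have hy : 1 ≤ w ^ β := Real.one_le_rpow hw hβ.le
    have h1 := hB (w ^ β) (by positivity)
    rw [← Real.rpow_mul hw0.le, mul_div_cancel₀ _ hβ.ne', Real.rpow_add hw0, Real.rpow_natCast] at h1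
    set y := w ^ β with hy_def
    -- One half of the exponential yields the factor T through exp(-u) ≤ 1/u; the other half, with T
    -- ≤ 1, beats the polynomial.
    have e1 : Real.exp (-κ * y / T) = Real.exp (-(κ * y / (2 * T))) * Real.exp (-(κ * y / (2 * T))) := by
      rw [← Real.exp_add]; congr 1; field_simp; ring
    have e2 : Real.exp (-(κ * y / (2 * T))) ≤ 2 / κ * T := by
      have hu : 0 < κ * y / (2 * T) := by positivity
      rw [Real.exp_neg]
      refine (inv_anti₀ hu (by linarith [Real.add_one_le_exp (κ * y / (2 * T))])).trans ?_
      rw [inv_div, div_mul_eq_mul_div]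
      gcongr
      nlinarith
    have e3 : Real.exp (-(κ * y / (2 * T))) ≤ Real.exp (-(κ / 2) * y) := by
      rw [Real.exp_le_exp, neg_mul, neg_le_neg_iff, le_div_iff₀ (by positivity)]
      nlinarith [mul_pos hκ (by linarith : (0 : ℝ) < y)]
    rw [e1, Real.rpow_neg hw0.le]
    have hw2 : 0 < w ^ (2 : ℝ) := by positivity
    rw [← div_eq_mul_inv, le_div_iff₀ hw2]
    calc w ^ m * (Real.exp (-(κ * y / (2 * T))) * Real.exp (-(κ * y / (2 * T)))) * w ^ (2 : ℝ)
        ≤ w ^ m * (2 / κ * T * Real.exp (-(κ / 2) * y)) * w ^ (2 : ℝ) := by gcongr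
      _ = 2 / κ * T * (w ^ m * w ^ (2 : ℝ) * Real.exp (-(κ / 2) * y)) := by ring
      _ ≤ 2 / κ * T * B := by gcongr
      _ = 2 / κ * B * T := by ring
  calc ∫⁻ η : ℝ, ENNReal.ofReal ((1 + |η|) ^ m * Real.exp (-κ * (1 + |η|) ^ β / T))
      ≤ ∫⁻ η : ℝ, ENNReal.ofReal (2 / κ * B * T * (1 + ‖η‖) ^ (-(2 : ℝ))) :=
        lintegral_mono fun η => ENNReal.ofReal_le_ofReal (hpt η)
    _ = ENNReal.ofReal (∫ η : ℝ, 2 / κ * B * T * (1 + ‖η‖) ^ (-(2 : ℝ))) :=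
        (ofReal_integral_eq_lintegral_ofReal (hint.const_mul _)
          (ae_of_all _ fun η => by positivity)).symm
    _ = _ := by rw [integral_const_mul]; congr 1; ring

namespace RegularDispersion

variable {v : ℝ → ℝ} {k : ℕ} {C β κ L : ℝ}

theorem continuous (hv : RegularDispersion v k C β κ L) : Continuous v := hv.contDiff.continuous

theorem differentiable (hv : RegularDispersion v k C β κ L) : Differentiable ℝ v :=
  hv.contDiff.differentiable (by norm_num)

theorem contDiff_deriv (hv : RegularDispersion v k C β κ L) : ContDiff ℝ 1 (deriv v) :=
  (contDiff_succ_iff_deriv (n := 1)).1 hv.contDiff |>.2.2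

theorem continuous_deriv (hv : RegularDispersion v k C β κ L) : Continuous (deriv v) :=
  hv.contDiff_deriv.continuous

/-- By Rolle, v is injective on the ball, so x = v(η)/T is a change of variables whose Jacobian is
at least c/T. -/
theorem setLIntegral_comp_div_le (hv : RegularDispersion v k C β κ L) (g : ℝ → ENNReal) {z r c T : ℝ}
    (hc : 0 < c) (hT : 0 < T) (hz : ∀ ξ ∈ Metric.ball z r, c ≤ |deriv v ξ|) :
    ∫⁻ η in Metric.ball z r, g (v η / T) ≤ ENNReal.ofReal (T / c) * ∫⁻ x, g x := by
  have hinj : Set.InjOn (fun η => v η / T) (Metric.ball z r) := by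
    have main : ∀ x ∈ Metric.ball z r, ∀ y ∈ Metric.ball z r, x < y → v x ≠ v y := by
      intro x hx y hy hxy he
      obtain ⟨ζ, hζ, h0⟩ := exists_deriv_eq_zero hxy hv.continuous.continuousOn he
      have : ζ ∈ Metric.ball z r :=
        (convex_ball z r).ordConnected.out hx hy ⟨hζ.1.le, hζ.2.le⟩
      have := hz ζ this
      rw [h0, abs_zero] at this
      linarith
    intro x hx y hy he
    have he' : v x = v y := by
      have : v x / T = v y / T := he
      field_simp at this
      exact this
    rcases lt_trichotomy x y with h | h | h
    · exact absurd he' (main x hx y hy h)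
    · exact h
    · exact absurd he'.symm (main y hy x hx h)
  have h := lintegral_image_eq_lintegral_abs_deriv_mul (f := fun η => v η / T)
    (f' := fun η => deriv v η / T) measurableSet_ball
    (fun x _ => ((hv.differentiable x).hasDerivAt.div_const T).hasDerivWithinAt) hinj g
  have h1 : ENNReal.ofReal (c / T) * ∫⁻ η in Metric.ball z r, g (v η / T) ≤ ∫⁻ x, g x := by
    rw [← lintegral_const_mul' _ _ ENNReal.ofReal_ne_top]
    calc ∫⁻ η in Metric.ball z r, ENNReal.ofReal (c / T) * g (v η / T)
        ≤ ∫⁻ η in Metric.ball z r, ENNReal.ofReal |deriv v η / T| * g (v η / T) := by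
          refine setLIntegral_mono' measurableSet_ball fun η hη => ?_
          gcongr
          rw [abs_div, abs_of_pos hT]
          gcongr
          exact hz η hη
      _ ≤ ∫⁻ x, g x := by rw [← h]; exact setLIntegral_le_lintegral _ _
  calc ∫⁻ η in Metric.ball z r, g (v η / T)
      = ENNReal.ofReal (T / c) * (ENNReal.ofReal (c / T) * ∫⁻ η in Metric.ball z r, g (v η / T)) := by
        rw [← mul_assoc, ← ENNReal.ofReal_mul (by positivity), div_mul_div_cancel₀ hc.ne',
          div_self hT.ne', ENNReal.ofReal_one, one_mul]
    _ ≤ _ := by gcongr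

/-- This is the source of every factor T. Near the compact zero set of v, finitely many balls with
v' bounded away from 0 each contribute O(T) by substitution. Off these balls |v| dominates a
multiple of (1 + |η|)^β, and the exponential tail of g takes over. -/
theorem exists_lintegral_comp_div_le (hv : RegularDispersion v k C β κ L) {g : ℝ → ENNReal}
    (hgi : ∫⁻ x, g x < ⊤) {X C₁ s : ℝ} (hs : 0 < s) (hC₁ : 0 ≤ C₁)
    (hg : ∀ x, X ≤ |x| → g x ≤ ENNReal.ofReal (C₁ * Real.exp (-s * |x|))) (m : ℕ) :
    ∃ C₂ : ℝ, 0 ≤ C₂ ∧ ∀ᶠ T : ℝ in 𝓝[>] 0,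
      ∫⁻ η, ENNReal.ofReal ((1 + |η|) ^ m) * g (v η / T) ≤ ENNReal.ofReal (C₂ * T) := by
  have hloc : ∀ z, v z = 0 → ∃ r > 0, ∃ c > 0, ∀ ξ ∈ Metric.ball z r, c ≤ |deriv v ξ| := by
    intro z hz
    have hpos : |deriv v z| / 2 < |deriv v z| :=
      half_lt_self (abs_pos.2 (hv.nondegenerate z hz))
    have hev := hv.continuous_deriv.abs.continuousAt.eventually_const_lt hpos
    obtain ⟨r, hr, hb⟩ := Metric.eventually_nhds_iff_ball.1 hev
    exact ⟨r, hr, |deriv v z| / 2, half_pos (abs_pos.2 (hv.nondegenerate z hz)),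
      fun ξ hξ => (hb ξ hξ).le⟩
  choose! r hr c hc hrc using hloc
  have hfar : ∀ η, L ≤ |η| → κ * (1 + |η|) ^ β ≤ v η := fun η hη => hv.growth η hη η (by simp)
  have hL := hv.one_le
  have hZc : IsCompact {z | v z = 0} := by
    refine (isCompact_Icc (a := -L) (b := L)).of_isClosed_subset
      (isClosed_eq hv.continuous continuous_const) fun z hz => ?_
    refine abs_le.1 ?_
    by_contra hc
    have h1 := hfar z (not_le.1 hc).le
    have h2 := hv.rate_pos
    have : 0 < κ * (1 + |z|) ^ β := by positivity
    have h3 : v z = 0 := hz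
    linarith
  obtain ⟨t, htZ, htc⟩ := hZc.elim_nhds_subcover (fun z => Metric.ball z (r z))
    fun z hz => Metric.ball_mem_nhds z (hr z hz)
  set W := ⋃ z ∈ t, Metric.ball z (r z) with hW
  have hWo : IsOpen W := isOpen_biUnion fun z _ => Metric.isOpen_ball
  obtain ⟨m₀, hm₀, hm₀'⟩ : ∃ m₀, 0 < m₀ ∧ ∀ x ∈ Set.Icc (-L) L \ W, m₀ ≤ |v x| := by
    refine (isCompact_Icc.diff hWo).exists_forall_le' (f := fun x => |v x|)
      hv.continuous.abs.continuousOn fun x hx => ?_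
    rw [abs_pos]
    exact fun h => hx.2 (htc h)
  have hκ := hv.rate_pos
  -- Growth gives the rate beyond L; on the compact remainder |v| has a positive minimum m₀,
  -- rescaled by (1 + L)^β.
  obtain ⟨κ', hκ', hoff⟩ : ∃ κ' > 0, ∀ η, η ∉ W → κ' * (1 + |η|) ^ β ≤ |v η| := by
    have hp : 0 < (1 + L) ^ β := by positivity
    refine ⟨min κ (m₀ / (1 + L) ^ β), by positivity, fun η hη => ?_⟩
    have hq : 0 ≤ (1 + |η|) ^ β := by positivity
    rcases le_or_gt L |η| with h | h
    · refine le_trans ?_ ((hfar η h).trans (le_abs_self _))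
      gcongr
      exact min_le_left _ _
    · refine le_trans ?_ (hm₀' η ⟨abs_le.1 h.le, hη⟩)
      calc min κ (m₀ / (1 + L) ^ β) * (1 + |η|) ^ β ≤ m₀ / (1 + L) ^ β * (1 + L) ^ β := by
            gcongr
            · exact min_le_right _ _
            · exact hv.exponent_pos.le
        _ = m₀ := div_mul_cancel₀ _ hp.ne'
  have hWint : ∀ t' : Finset ℝ, (∀ z ∈ t', v z = 0) → ∃ D : ℝ, 0 ≤ D ∧ ∀ T : ℝ, 0 < T →
      ∫⁻ η in ⋃ z ∈ t', Metric.ball z (r z), ENNReal.ofReal ((1 + |η|) ^ m) * g (v η / T) ≤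
        ENNReal.ofReal (D * T) := by
    intro t'
    induction t' using Finset.induction_on with
    | empty => intro _; exact ⟨0, le_rfl, fun T _ => by simp⟩
    | insert z t' hzt ih =>
      intro hz
      obtain ⟨D, hD, hDT⟩ := ih fun y hy => hz y (Finset.mem_insert_of_mem hy)
      have hz0 := hz z (Finset.mem_insert_self _ _)
      have hcz := hc z hz0
      have hrz := hr z hz0
      refine ⟨(1 + |z| + r z) ^ m * ((∫⁻ x, g x).toReal / c z) + D, by positivity,
        fun T hT => ?_⟩
      rw [Finset.set_biUnion_insert, add_mul, ENNReal.ofReal_add (by positivity) (by positivity)]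
      refine (lintegral_union_le _ _ _).trans (add_le_add ?_ (hDT T hT))
      calc ∫⁻ η in Metric.ball z (r z), ENNReal.ofReal ((1 + |η|) ^ m) * g (v η / T)
          ≤ ∫⁻ η in Metric.ball z (r z), ENNReal.ofReal ((1 + |z| + r z) ^ m) * g (v η / T) := by
            refine setLIntegral_mono' measurableSet_ball fun η hη => ?_
            rw [Metric.mem_ball, Real.dist_eq] at hη
            have : |η| ≤ |η - z| + |z| := by simpa using abs_add_le (η - z) z
            gcongr ENNReal.ofReal (?_ ^ m) * _
            linarith
        _ = ENNReal.ofReal ((1 + |z| + r z) ^ m) * ∫⁻ η in Metric.ball z (r z), g (v η / T) :=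
            lintegral_const_mul' _ _ ENNReal.ofReal_ne_top
        _ ≤ ENNReal.ofReal ((1 + |z| + r z) ^ m) * (ENNReal.ofReal (T / c z) * ∫⁻ x, g x) := by
            gcongr
            exact hv.setLIntegral_comp_div_le g hcz hT (hrc z hz0)
        _ = _ := by
            rw [← ENNReal.ofReal_toReal hgi.ne, ← ENNReal.ofReal_mul (by positivity),
              ← ENNReal.ofReal_mul (by positivity), ENNReal.toReal_ofReal ENNReal.toReal_nonneg]
            congr 1
            ring
  obtain ⟨D₁, hD₁, hD₁'⟩ := hWint t htZ
  obtain ⟨D₂, hD₂, hD₂'⟩ := exists_lintegral_pow_mul_exp_neg_div_le hv.exponent_pos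
    (mul_pos hs hκ') m
  refine ⟨D₁ + C₁ * D₂, by positivity, ?_⟩
  -- For such T the argument v/T exceeds X in absolute value everywhere off W, so the tail bound of
  -- g applies there.
  have hev : ∀ᶠ T : ℝ in 𝓝[>] 0, T * X ≤ κ' := by
    have : Tendsto (fun T : ℝ => T * X) (𝓝[>] 0) (𝓝 (0 * X)) :=
      ((continuous_id.mul continuous_const).tendsto 0).mono_left nhdsWithin_le_nhds
    rw [zero_mul] at this
    exact this.eventually_le_const hκ'
  filter_upwards [hev, Ioc_mem_nhdsGT zero_lt_one] with T hTX hT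
  obtain ⟨hT0, hT1⟩ := hT
  rw [← lintegral_add_compl _ hWo.measurableSet, add_mul,
    ENNReal.ofReal_add (by positivity) (by positivity)]
  refine add_le_add (hD₁' T hT0) ?_
  calc ∫⁻ η in Wᶜ, ENNReal.ofReal ((1 + |η|) ^ m) * g (v η / T)
      ≤ ∫⁻ η in Wᶜ, ENNReal.ofReal C₁ *
          ENNReal.ofReal ((1 + |η|) ^ m * Real.exp (-(s * κ') * (1 + |η|) ^ β / T)) := by
        refine setLIntegral_mono' hWo.measurableSet.compl fun η hη => ?_
        have h1 := hoff η hη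
        have h2 : 1 ≤ (1 + |η|) ^ β :=
          Real.one_le_rpow (by linarith [abs_nonneg η]) hv.exponent_pos.le
        have h3 : |v η / T| = |v η| / T := by rw [abs_div, abs_of_pos hT0]
        have h4 : X ≤ |v η / T| := by
          rw [h3, le_div_iff₀ hT0]; nlinarith
        rw [← ENNReal.ofReal_mul hC₁]
        refine (mul_le_mul_right (hg _ h4) _).trans ?_
        rw [← ENNReal.ofReal_mul (by positivity)]
        refine ENNReal.ofReal_le_ofReal ?_
        have h5 : Real.exp (-s * |v η / T|) ≤ Real.exp (-(s * κ') * (1 + |η|) ^ β / T) := by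
          rw [Real.exp_le_exp, h3, ← mul_div_assoc]
          gcongr ?_ / T
          nlinarith
        calc (1 + |η|) ^ m * (C₁ * Real.exp (-s * |v η / T|))
            ≤ (1 + |η|) ^ m * (C₁ * Real.exp (-(s * κ') * (1 + |η|) ^ β / T)) := by gcongr
          _ = _ := by ring
    _ ≤ ∫⁻ η, ENNReal.ofReal C₁ *
          ENNReal.ofReal ((1 + |η|) ^ m * Real.exp (-(s * κ') * (1 + |η|) ^ β / T)) :=
        setLIntegral_le_lintegral _ _
    _ = ENNReal.ofReal C₁ * ∫⁻ η,
          ENNReal.ofReal ((1 + |η|) ^ m * Real.exp (-(s * κ') * (1 + |η|) ^ β / T)) :=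
        lintegral_const_mul' _ _ ENNReal.ofReal_ne_top
    _ ≤ ENNReal.ofReal C₁ * ENNReal.ofReal (D₂ * T) := by gcongr; exact hD₂' T hT0 hT1
    _ = _ := by rw [← ENNReal.ofReal_mul hC₁, mul_assoc]

end RegularDispersion

/-! ### Second-order interpolation of the symbol -/

theorem abs_sub_sub_mul_le {a a₁ a₂ : ℝ → ℝ} {η D S : ℝ} (ha : ∀ x, HasDerivAt a (a₁ x) x)
    (ha₁ : ∀ x, HasDerivAt a₁ (a₂ x) x) (hS : ∀ ζ, |ζ - η| ≤ D → |a₂ ζ| ≤ S) {y : ℝ}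
    (hy : |y - η| ≤ D) : |a y - a η - a₁ η * (y - η)| ≤ S * (y - η) ^ 2 := by
  have hS' : ∀ ζ ∈ Metric.closedBall η |y - η|, ‖a₂ ζ‖ ≤ S := fun ζ hζ =>
    hS ζ (le_trans (by simpa [Real.dist_eq] using hζ) hy)
  have hmem : y ∈ Metric.closedBall η |y - η| := by simp [Real.dist_eq]
  have hmem' : η ∈ Metric.closedBall η |y - η| := by simp
  have hS0 : 0 ≤ S := (norm_nonneg _).trans (hS' y hmem)
  have h1 : ∀ ζ ∈ Metric.closedBall η |y - η|, ‖a₁ ζ - a₁ η‖ ≤ S * |y - η| := by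
    intro ζ hζ
    refine ((convex_closedBall η |y - η|).norm_image_sub_le_of_norm_hasDerivWithin_le
      (fun x _ => (ha₁ x).hasDerivWithinAt) hS' hmem' hζ).trans ?_
    gcongr
    simpa [Real.dist_eq] using hζ
  have h2 := (convex_closedBall η |y - η|).norm_image_sub_le_of_norm_hasDerivWithin_le
    (f := fun x => a x - a₁ η * x) (f' := fun x => a₁ x - a₁ η)
    (fun x _ => by
      simpa using ((ha x).fun_sub ((hasDerivAt_id x).const_mul (a₁ η))).hasDerivWithinAt) h1 hmem' hmem
  rw [Real.norm_eq_abs, Real.norm_eq_abs, mul_assoc, ← sq, sq_abs] at h2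
  rwa [show a y - a η - a₁ η * (y - η) = a y - a₁ η * y - (a η - a₁ η * η) by ring]

/-- The point η is the barycentre of the two ends, so the first-order Taylor terms cancel; the
quadratic remainders add up through (1-t)t² + t(1-t)² = t(1-t). -/
theorem abs_interpolation_sub_le {a a₁ a₂ : ℝ → ℝ} {η d S : ℝ} (ha : ∀ x, HasDerivAt a (a₁ x) x)
    (ha₁ : ∀ x, HasDerivAt a₁ (a₂ x) x) (hS : ∀ ζ, |ζ - η| ≤ |d| → |a₂ ζ| ≤ S) {t : ℝ}
    (ht0 : 0 ≤ t) (ht1 : t ≤ 1) :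
    |(1 - t) * a (η - t * d) + t * a (η + (1 - t) * d) - a η| ≤ t * (1 - t) * d ^ 2 * S := by
  have h1t : 0 ≤ 1 - t := by linarith
  have hd := abs_nonneg d
  have e1 := abs_sub_sub_mul_le ha ha₁ hS (y := η - t * d) (by
    rw [sub_sub_cancel_left, abs_neg, abs_mul, abs_of_nonneg ht0]; nlinarith)
  have e2 := abs_sub_sub_mul_le ha ha₁ hS (y := η + (1 - t) * d) (by
    rw [add_sub_cancel_left, abs_mul, abs_of_nonneg h1t]; nlinarith)
  have e3 := mul_le_mul_of_nonneg_left e1 h1t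
  have e4 := mul_le_mul_of_nonneg_left e2 ht0
  rw [← abs_of_nonneg h1t, ← abs_mul, abs_of_nonneg h1t] at e3
  rw [← abs_of_nonneg ht0, ← abs_mul, abs_of_nonneg ht0] at e4
  have e5 := abs_add_le ((1 - t) * (a (η - t * d) - a η - a₁ η * (η - t * d - η)))
    (t * (a (η + (1 - t) * d) - a η - a₁ η * (η + (1 - t) * d - η)))
  calc |(1 - t) * a (η - t * d) + t * a (η + (1 - t) * d) - a η|
      = |(1 - t) * (a (η - t * d) - a η - a₁ η * (η - t * d - η)) +
        t * (a (η + (1 - t) * d) - a η - a₁ η * (η + (1 - t) * d - η))| := by congr 1; ring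
    _ ≤ _ := e5
    _ ≤ (1 - t) * (S * (η - t * d - η) ^ 2) + t * (S * (η + (1 - t) * d - η) ^ 2) :=
      add_le_add e3 e4
    _ = _ := by ring

namespace RegularDispersion

variable {v : ℝ → ℝ} {k : ℕ} {C β κ L : ℝ}

theorem hasDerivAt_fermiFun_div (hv : RegularDispersion v k C β κ L) (T x : ℝ) :
    HasDerivAt (fun ξ => fermiFun (v ξ / T)) (-(fermiWidth (v x / T) * (deriv v x / T))) x := by
  have := (hasDerivAt_fermiFun (v x / T)).comp x ((hv.differentiable x).hasDerivAt.div_const T)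
  refine this.congr_deriv ?_
  ring

theorem hasDerivAt_fermiFun_div_deriv (hv : RegularDispersion v k C β κ L) (T x : ℝ) :
    HasDerivAt (fun ξ => -(fermiWidth (v ξ / T) * (deriv v ξ / T)))
      (-(-(fermiWidth (v x / T) * (1 - 2 * fermiFun (v x / T))) * (deriv v x / T) *
        (deriv v x / T) + fermiWidth (v x / T) * (deriv (deriv v) x / T))) x := by
  have h1 := (hasDerivAt_fermiWidth (v x / T)).comp x ((hv.differentiable x).hasDerivAt.div_const T)
  have h2 : HasDerivAt (deriv v) (deriv (deriv v) x) x :=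
    (hv.contDiff_deriv.differentiable (by norm_num) x).hasDerivAt
  exact (h1.mul (h2.div_const T)).neg

theorem abs_second_deriv_le (hv : RegularDispersion v k C β κ L) {T : ℝ} (hT : 0 < T) (hT1 : T ≤ 1)
    (x : ℝ) :
    |(-(-(fermiWidth (v x / T) * (1 - 2 * fermiFun (v x / T))) * (deriv v x / T) *
        (deriv v x / T) + fermiWidth (v x / T) * (deriv (deriv v) x / T)))| ≤
      (C ^ 2 + C) * (1 + |x|) ^ (2 * k) / T ^ 2 * fermiWidth (v x / T) := by
  have hq := fermiWidth_pos (v x / T)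
  have hφ := abs_one_sub_two_mul_fermiFun_le (v x / T)
  have hC := hv.const_nonneg
  have h1 := hv.deriv_le x
  have h2 := hv.deriv_deriv_le x
  set q := fermiWidth (v x / T)
  set w := (1 + |x|) ^ k with hw
  have hw1 : 1 ≤ w := one_le_pow₀ (by linarith [abs_nonneg x])
  have hw2 : (1 + |x|) ^ (2 * k) = w ^ 2 := by rw [hw, ← pow_mul, mul_comm]
  rw [hw2, abs_neg]
  refine (abs_add_le _ _).trans ?_
  rw [abs_mul, abs_mul, abs_neg, abs_mul, abs_mul, abs_div, abs_div, abs_of_pos hq, abs_of_pos hT]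
  have e1 : q * |1 - 2 * fermiFun (v x / T)| * (|deriv v x| / T) * (|deriv v x| / T) ≤
      q * 1 * (C * w / T) * (C * w / T) := by gcongr
  have e2 : q * (|deriv (deriv v) x| / T) ≤ q * (C * w ^ 2 / T ^ 2) := by
    gcongr q * ?_
    refine div_le_div₀ (by positivity) (h2.trans ?_) (by positivity) (by nlinarith)
    gcongr
    nlinarith
  refine (add_le_add e1 e2).trans_eq ?_
  field_simp

/-- Two regimes, according to the size of |d|(1 + |η|)^k against T. If it is O(T), then v/T varies
by O(1) near η, the width is comparable to its value at η, and the Lipschitz bound off t₀ produces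
the singular weight. Otherwise |d| ≤ T forces |η| to be large, and the exponential smallness of the
width makes the plain Hölder bound enough. -/
theorem exists_enorm_sub_le (hv : RegularDispersion v k C β κ L) {f : ℝ → ℂ} {t₀ σ M : ℝ}
    (hf : HolderOffPoint f t₀ σ M) :
    ∃ (m : ℕ) (C₁ C₂ κ' : ℝ), 0 ≤ C₁ ∧ 0 ≤ C₂ ∧ 0 < κ' ∧ ∀ T : ℝ, 0 < T → T ≤ 1 → ∀ d : ℝ,
      |d| ≤ T → ∀ t ∈ Set.Ioo (0 : ℝ) 1, ∀ η : ℝ,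
      ‖f ((1 - t) * fermiFun (v (η - t * d) / T) + t * fermiFun (v (η + (1 - t) * d) / T)) -
          f (fermiFun (v η / T))‖ₑ ≤
        ENNReal.ofReal ((t * (1 - t)) ^ σ * (d / T) ^ 2) *
          (ENNReal.ofReal C₁ *
            (ENNReal.ofReal ((1 + |η|) ^ (2 * k)) * fermiSingularWeight t₀ σ (v η / T)) +
          ENNReal.ofReal C₂ *
            ENNReal.ofReal ((1 + |η|) ^ m * Real.exp (-κ' * (1 + |η|) ^ β / T))) := by
  have hC := hv.const_nonneg
  have hM := hf.const_nonneg
  have hL := hv.one_le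
  have hσ := hf.exponent_pos
  have hσ1 := hf.exponent_lt
  -- With this threshold, |d| ≤ T and |η| < L always fall in the first regime.
  set K := (1 + L) ^ k with hK
  have hK1 : 1 ≤ K := one_le_pow₀ (by linarith)
  set C₃ := (C ^ 2 + C) * 2 ^ (2 * k) with hC₃
  have hC₃0 : 0 ≤ C₃ := by positivity
  set C₄ := Real.exp (C * 2 ^ k * K) with hC₄
  -- Of the 4k powers, 2k come from the second derivative and 2k from recovering the factor (d/T)²
  -- in the second regime.
  refine ⟨4 * k, M * (C₃ * C₄), M * (1 + C₃), σ * κ, by positivity, by positivity,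
    mul_pos hσ hv.rate_pos, ?_⟩
  intro T hT hT1 d hd t ht η
  have htt : 0 < t * (1 - t) := mul_pos ht.1 (by linarith [ht.2])
  have htt1 : t * (1 - t) ≤ 1 := by nlinarith [ht.1, ht.2]
  set w := 1 + |η| with hw
  have hw1 : 1 ≤ w := by linarith [abs_nonneg η]
  have hball : ∀ ζ, |ζ - η| ≤ |d| → 1 + |ζ| ≤ 2 * w := by
    intro ζ hζ
    have : |ζ| ≤ |ζ - η| + |η| := by simpa using abs_add_le (ζ - η) η
    linarith
  have hsec : ∀ ζ, |ζ - η| ≤ |d| → (C ^ 2 + C) * (1 + |ζ|) ^ (2 * k) ≤ C₃ * w ^ (2 * k) := by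
    intro ζ hζ
    rw [hC₃, mul_assoc, ← mul_pow]
    gcongr
    exact hball ζ hζ
  have hdT : (d / T) ^ 2 ≤ 1 := by
    rw [← sq_abs, abs_div, abs_of_pos hT]
    exact pow_le_one₀ (by positivity) ((div_le_one hT).2 hd)
  have hcont := fun S hS => abs_interpolation_sub_le (a := fun ξ => fermiFun (v ξ / T)) (η := η)
    (d := d) (S := S) (t := t) (hv.hasDerivAt_fermiFun_div T) (hv.hasDerivAt_fermiFun_div_deriv T)
    hS ht.1.le ht.2.le
  set A := (1 - t) * fermiFun (v (η - t * d) / T) + t * fermiFun (v (η + (1 - t) * d) / T) with hA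
  have hdd : |d| ≤ 1 := hd.trans hT1
  rw [mul_add]
  rcases le_or_gt (|d| * w ^ k) (K * T) with hgood | hbad
  · refine le_trans ?_ le_self_add
    have hvd : ∀ ζ, |ζ - η| ≤ |d| → |v η / T - v ζ / T| ≤ C * 2 ^ k * K := by
      intro ζ hζ
      have h1 := (convex_closedBall η |d|).norm_image_sub_le_of_norm_deriv_le
        (fun x _ => hv.differentiable x) (C := C * (2 * w) ^ k) (fun x hx => by
          refine (hv.deriv_le x).trans ?_
          gcongr
          exact hball x (by simpa [Real.dist_eq] using hx))
        (x := η) (y := ζ) (by simp) (by simpa [Real.dist_eq] using hζ)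
      rw [Real.norm_eq_abs, Real.norm_eq_abs] at h1
      rw [← sub_div, abs_div, abs_of_pos hT, div_le_iff₀ hT, abs_sub_comm]
      calc |v ζ - v η| ≤ C * (2 * w) ^ k * |d| := h1.trans (by gcongr)
        _ = C * 2 ^ k * (|d| * w ^ k) := by rw [mul_pow]; ring
        _ ≤ C * 2 ^ k * (K * T) := by gcongr
        _ = _ := by ring
    have hAB : |A - fermiFun (v η / T)| ≤
        t * (1 - t) * d ^ 2 * (C₃ * w ^ (2 * k) / T ^ 2 * (C₄ * fermiWidth (v η / T))) := by
      refine hcont _ fun ζ hζ => (hv.abs_second_deriv_le hT hT1 ζ).trans ?_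
      have h2 := (fermiWidth_le_exp_abs_sub_mul (v η / T) (v ζ / T))
      have h3 : Real.exp |v η / T - v ζ / T| ≤ C₄ := Real.exp_le_exp.2 (hvd ζ hζ)
      have h4 := fermiWidth_pos (v η / T)
      have h5 := fermiWidth_pos (v ζ / T)
      gcongr ?_ / T ^ 2 * ?_
      · exact hsec ζ hζ
      · exact h2.trans (by gcongr)
    refine (hf.enorm_sub_le _ _).trans ?_
    rw [fermiSingularWeight, ← mul_assoc, ← mul_assoc, ← mul_assoc,
      ← ENNReal.ofReal_mul (by positivity), ← ENNReal.ofReal_mul (by positivity),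
      ← ENNReal.ofReal_mul (by positivity)]
    gcongr ENNReal.ofReal ?_ * _
    have hpow : t * (1 - t) ≤ (t * (1 - t)) ^ σ := by
      calc t * (1 - t) = (t * (1 - t)) ^ (1 : ℝ) := (Real.rpow_one _).symm
        _ ≤ _ := Real.rpow_le_rpow_of_exponent_ge htt htt1 hσ1.le
    have h4 := fermiWidth_pos (v η / T)
    calc M * |A - fermiFun (v η / T)| ≤ M * (t * (1 - t) * d ^ 2 *
          (C₃ * w ^ (2 * k) / T ^ 2 * (C₄ * fermiWidth (v η / T)))) := by gcongr
      _ = t * (1 - t) * ((d / T) ^ 2 * (M * (C₃ * C₄)) * w ^ (2 * k) * fermiWidth (v η / T)) := by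
          rw [div_pow]; ring
      _ ≤ (t * (1 - t)) ^ σ * ((d / T) ^ 2 * (M * (C₃ * C₄)) * w ^ (2 * k) *
          fermiWidth (v η / T)) := by gcongr
      _ = _ := by ring
  · refine le_trans ?_ le_add_self
    have hwL : L ≤ |η| := by
      by_contra hc
      have h1 : w ^ k ≤ K := by
        rw [hK]
        have := not_le.1 hc
        gcongr ?_ ^ k
        linarith
      have h2 : |d| * w ^ k ≤ T * K := by gcongr
      linarith
    have hAB : |A - fermiFun (v η / T)| ≤
        t * (1 - t) * d ^ 2 * (C₃ * w ^ (2 * k) / T ^ 2 * Real.exp (-κ * w ^ β / T)) := by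
      refine hcont _ fun ζ hζ => (hv.abs_second_deriv_le hT hT1 ζ).trans ?_
      have h2 := fermiWidth_le_exp (v ζ / T)
      have h3 := hv.growth η hwL ζ (hζ.trans hdd)
      have h5 := fermiWidth_pos (v ζ / T)
      gcongr ?_ / T ^ 2 * ?_
      · exact hsec ζ hζ
      · refine h2.trans (Real.exp_le_exp.2 ?_)
        rw [neg_mul, neg_div, neg_le_neg_iff]
        refine le_trans ?_ (le_abs_self _)
        gcongr
    rw [← ENNReal.ofReal_mul (by positivity), ← ENNReal.ofReal_mul (by positivity), ← ofReal_norm]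
    refine ENNReal.ofReal_le_ofReal ((hf.holder _ _).trans ?_)
    have h6 : t * (1 - t) * d ^ 2 * (C₃ * w ^ (2 * k) / T ^ 2 * Real.exp (-κ * w ^ β / T)) =
        t * (1 - t) * (d / T) ^ 2 * (C₃ * w ^ (2 * k)) * Real.exp (-κ * w ^ β / T) := by
      rw [div_pow]; ring
    have h7 : |A - fermiFun (v η / T)| ^ σ ≤ (t * (1 - t)) ^ σ * 1 *
        ((1 + C₃) * w ^ (2 * k)) * Real.exp (-(σ * κ) * w ^ β / T) := by
      refine (Real.rpow_le_rpow (abs_nonneg _) (hAB.trans_eq h6) hσ.le).trans ?_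
      rw [Real.mul_rpow (by positivity) (by positivity), Real.mul_rpow (by positivity) (by positivity),
        Real.mul_rpow htt.le (by positivity), ← Real.exp_mul]
      have g1 : ((d / T) ^ 2) ^ σ ≤ 1 := Real.rpow_le_one (by positivity) hdT hσ.le
      have g2 : (C₃ * w ^ (2 * k)) ^ σ ≤ (1 + C₃) * w ^ (2 * k) := by
        have hone : 1 ≤ w ^ (2 * k) := one_le_pow₀ hw1
        have hle : C₃ * w ^ (2 * k) ≤ (1 + C₃) * w ^ (2 * k) := by gcongr; linarith
        have hge : 1 ≤ (1 + C₃) * w ^ (2 * k) := by nlinarith [mul_nonneg hC₃0 (zero_le_one.trans hone)]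
        refine (Real.rpow_le_rpow (by positivity) hle hσ.le).trans ?_
        calc ((1 + C₃) * w ^ (2 * k)) ^ σ ≤ ((1 + C₃) * w ^ (2 * k)) ^ (1 : ℝ) :=
              Real.rpow_le_rpow_of_exponent_le hge hσ1.le
          _ = _ := Real.rpow_one _
      have g3 : -κ * w ^ β / T * σ = -(σ * κ) * w ^ β / T := by ring
      rw [g3]
      gcongr
    -- The Hölder bound would only give (d/T)^(2σ); in this regime the full (d/T)² can be inserted
    -- at the cost of w^(2k).
    have h8 : 1 ≤ (d / T) ^ 2 * w ^ (2 * k) := by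
      have : 1 ≤ |d| / T * w ^ k := by
        rw [div_mul_eq_mul_div, le_div_iff₀ hT]
        nlinarith
      calc (1 : ℝ) ≤ (|d| / T * w ^ k) ^ 2 := one_le_pow₀ this
        _ = _ := by rw [mul_pow, div_pow, div_pow, sq_abs, ← pow_mul, mul_comm k 2]
    calc M * |A - fermiFun (v η / T)| ^ σ ≤ M * ((t * (1 - t)) ^ σ * 1 *
          ((1 + C₃) * w ^ (2 * k)) * Real.exp (-(σ * κ) * w ^ β / T)) := by gcongr
      _ ≤ M * ((t * (1 - t)) ^ σ * ((d / T) ^ 2 * w ^ (2 * k)) *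
          ((1 + C₃) * w ^ (2 * k)) * Real.exp (-(σ * κ) * w ^ β / T)) := by gcongr
      _ = _ := by rw [show 4 * k = 2 * k + 2 * k by ring, pow_add]; ring

end RegularDispersion

/-! ### The shift integral for |d| ≤ T -/

/-- The integral of `U(a(ξ), a(ξ + d); f)` over `ξ`. -/
noncomputable def widomShift (a : ℝ → ℝ) (f : ℝ → ℂ) (d : ℝ) : ℂ :=
  ∫ ξ, widomU (a ξ) (a (ξ + d)) f

theorem rpow_abs_sub_le {p : ℝ} (hp : 0 < p) (hp1 : p ≤ 1) (x y : ℝ) :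
    |x - y| ^ p ≤ |x| ^ p + |y| ^ p := by
  have h : |x - y| ≤ |x| + |y| := by
    have := abs_add_le x (-y)
    rwa [abs_neg, ← sub_eq_add_neg] at this
  exact (Real.rpow_le_rpow (abs_nonneg _) h hp.le).trans
    (Real.rpow_add_le_add_rpow (abs_nonneg _) (abs_nonneg _) hp.le hp1)

namespace HolderOffPoint

variable {f : ℝ → ℂ} {t₀ σ M : ℝ} {a : ℝ → ℝ}

theorem integrable_widomU_shift (hf : HolderOffPoint f t₀ σ M) (ha : Measurable a)
    (hi : Integrable fun ξ => |a ξ| ^ σ) (d : ℝ) :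
    Integrable fun ξ => widomU (a ξ) (a (ξ + d)) f := by
  refine (((hi.add (hi.comp_add_right d)).const_mul (2 * M * betaDiag σ))).mono' ?_ ?_
  · exact ((measurable_widomU hf.continuous).comp
      (ha.prodMk (ha.comp (measurable_id.add_const d)))).aestronglyMeasurable
  · refine ae_of_all _ fun ξ => (hf.norm_widomU_le _ _).trans ?_
    have h1 := betaDiag_nonneg σ
    have h2 := hf.const_nonneg
    exact mul_le_mul_of_nonneg_left (rpow_abs_sub_le hf.exponent_pos hf.exponent_lt.le _ _)
      (by positivity)

/-- For fixed t, the integral over ξ of f(a(ξ+td)) - (1-t) f(a(ξ)) - t f(a(ξ+d)) vanishes by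
translation invariance. Thus the linear interpolation inside U may be traded for f(a(ξ+td)), which
is what makes J quadratic in d. -/
theorem enorm_widomShift_le (hf : HolderOffPoint f t₀ σ M) (ha : Measurable a)
    (hi : Integrable fun ξ => |a ξ| ^ σ) (d : ℝ) :
    ‖widomShift a f d‖ₑ ≤ ∫⁻ t in Set.Ioc (0 : ℝ) 1, ∫⁻ ξ,
      ‖(f ((1 - t) * a ξ + t * a (ξ + d)) - f (a (ξ + t * d))) / ((t : ℂ) * (1 - t))‖ₑ := by
  set E : ℝ × ℝ → ℂ := fun p =>
    (f ((1 - p.2) * a p.1 + p.2 * a (p.1 + d)) - f (a (p.1 + p.2 * d))) /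
      ((p.2 : ℂ) * (1 - p.2)) with hE
  set V : ℝ × ℝ → ℂ := fun p => widomUIntegrand (a p.1) (a (p.1 + d)) f p.2 with hV
  set ν : Measure ℝ := volume.restrict (Set.Ioc (0 : ℝ) 1) with hν
  have hfm := hf.continuous.measurable
  have hEm : Measurable E := by
    have h1 : Measurable fun p : ℝ × ℝ => a (p.1 + d) := ha.comp (by fun_prop)
    have h2 : Measurable fun p : ℝ × ℝ => a (p.1 + p.2 * d) := ha.comp (by fun_prop)
    have h3 : Measurable fun p : ℝ × ℝ => (1 - p.2) * a p.1 + p.2 * a (p.1 + d) :=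
      ((measurable_const.sub measurable_snd).mul (ha.comp measurable_fst)).add
        (measurable_snd.mul h1)
    have h4 : Measurable fun p : ℝ × ℝ => (p.2 : ℂ) * (1 - p.2) := by fun_prop
    exact ((hfm.comp h3).sub (hfm.comp h2)).div h4
  have hVm : Measurable V := by
    have h1 : Measurable fun p : ℝ × ℝ => a (p.1 + d) := ha.comp (by fun_prop)
    have h2 : Measurable fun p : ℝ × ℝ => ((a p.1, a (p.1 + d)), p.2) := by fun_prop
    have h3 := (measurable_widomUIntegrand hf.continuous).comp h2
    rwa [Function.comp_def] at h3
  rw [← lintegral_prod_symm (μ := volume) (ν := ν) (fun p => ‖E p‖ₑ) hEm.enorm.aemeasurable]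
  -- An infinite right-hand side leaves nothing to prove; a finite one gives the integrability of E
  -- needed for Fubini.
  rcases eq_top_or_lt_top (∫⁻ p, ‖E p‖ₑ ∂(volume.prod ν)) with htop | htop
  · rw [htop]; exact le_top
  have hEi : Integrable E (volume.prod ν) := ⟨hEm.aestronglyMeasurable, htop⟩
  have hVi : Integrable V (volume.prod ν) := by
    have hw : Integrable (fun t : ℝ => (t * (1 - t)) ^ (σ - 1)) ν :=
      (intervalIntegrable_iff_integrableOn_Ioc_of_le zero_le_one).1
        (intervalIntegrable_mul_one_sub_rpow hf.exponent_pos)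
    refine ((((hi.add (hi.comp_add_right d)).const_mul (2 * M))).mul_prod hw).mono'
      hVm.aestronglyMeasurable ?_
    have hmem : ∀ᵐ p ∂(volume : Measure ℝ).prod ν, p.2 ∈ Set.Ioc (0 : ℝ) 1 :=
      Measure.quasiMeasurePreserving_snd.ae (ae_restrict_mem measurableSet_Ioc)
    filter_upwards [hmem] with p hp
    refine (hf.norm_widomUIntegrand_le _ _ ⟨hp.1.le, hp.2⟩).trans ?_
    have h2 := hf.const_nonneg
    refine mul_le_mul_of_nonneg_right ?_ (Real.rpow_nonneg
      (mul_nonneg hp.1.le (by linarith [hp.2])) _)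
    exact mul_le_mul_of_nonneg_left (rpow_abs_sub_le hf.exponent_pos hf.exponent_lt.le _ _)
      (by positivity)
  -- Subtracting f 0 makes F integrable, and the constant drops out since 1 - (1-t) - t = 0.
  set F : ℝ → ℂ := fun ξ => f (a ξ) - f 0 with hF
  have hFi : Integrable F := by
    refine (hi.const_mul M).mono' ((hfm.comp ha).sub_const _).aestronglyMeasurable
      (ae_of_all _ fun ξ => ?_)
    simpa using hf.holder (a ξ) 0
  have hdiff : ∀ ξ t : ℝ, V (ξ, t) - E (ξ, t) =
      (F (ξ + t * d) - (1 - (t : ℂ)) * F ξ - t * F (ξ + d)) / ((t : ℂ) * (1 - t)) := by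
    intro ξ t
    simp only [hV, hE, hF, widomUIntegrand]
    rw [← sub_div]
    congr 1
    ring
  have hzero : ∫ p, (V p - E p) ∂(volume.prod ν) = 0 := by
    rw [integral_prod_symm (fun p => V p - E p) (hVi.sub hEi)]
    refine integral_eq_zero_of_ae (ae_of_all _ fun t => ?_)
    simp only [hdiff, Pi.zero_apply]
    have hF1 := hFi.comp_add_right (t * d)
    have hF2 := hFi.const_mul (1 - (t : ℂ))
    rw [integral_div, integral_sub (f := fun ξ => F (ξ + t * d) - (1 - (t : ℂ)) * F ξ)
      (hF1.sub hF2) ((hFi.comp_add_right d).const_mul _), integral_sub hF1 hF2,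
      integral_const_mul, integral_const_mul, integral_add_right_eq_self F,
      integral_add_right_eq_self F]
    ring_nf
  have hJ : widomShift a f d = ∫ p, E p ∂(volume.prod ν) := by
    rw [integral_sub hVi hEi, sub_eq_zero] at hzero
    rw [← hzero, integral_prod _ hVi]
    simp only [widomShift, widomU, intervalIntegral.integral_of_le zero_le_one, hV, hν]
  rw [hJ]
  exact enorm_integral_le_lintegral_enorm _

end HolderOffPoint

namespace RegularDispersion

variable {v : ℝ → ℝ} {k : ℕ} {C β κ L : ℝ} {f : ℝ → ℂ} {t₀ σ M : ℝ}

theorem exists_lintegral_exp_le (hv : RegularDispersion v k C β κ L) {s : ℝ} (hs : 0 < s) :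
    ∃ C₂ : ℝ, 0 ≤ C₂ ∧ ∀ᶠ T : ℝ in 𝓝[>] 0,
      ∫⁻ η, ENNReal.ofReal (Real.exp (-s * |v η / T|)) ≤ ENNReal.ofReal (C₂ * T) := by
  have hi : ∫⁻ x : ℝ, ENNReal.ofReal (Real.exp (-s * |x|)) < ⊤ := by
    obtain ⟨B, -, hB⟩ := exists_lintegral_pow_mul_exp_neg_div_le zero_lt_one hs 0
    have h1 := hB 1 zero_lt_one le_rfl
    have h2 : ∀ x : ℝ, ENNReal.ofReal (Real.exp (-s * |x|)) = ENNReal.ofReal (Real.exp s) *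
        ENNReal.ofReal ((1 + |x|) ^ 0 * Real.exp (-s * (1 + |x|) ^ (1 : ℝ) / 1)) := by
      intro x
      rw [← ENNReal.ofReal_mul (Real.exp_pos _).le, pow_zero, one_mul, ← Real.exp_add,
        Real.rpow_one]
      congr 2
      ring
    simp only [h2]
    rw [lintegral_const_mul' _ _ ENNReal.ofReal_ne_top]
    exact ENNReal.mul_lt_top ENNReal.ofReal_lt_top (h1.trans_lt ENNReal.ofReal_lt_top)
  obtain ⟨C₂, h0, h⟩ := hv.exists_lintegral_comp_div_le
    (g := fun x => ENNReal.ofReal (Real.exp (-s * |x|))) hi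
    (X := 0) hs zero_le_one (fun x _ => by rw [one_mul]) 0
  refine ⟨C₂, h0, h.mono fun T hT => ?_⟩
  simpa using hT

theorem measurableSet_neg (hv : RegularDispersion v k C β κ L) : MeasurableSet {ξ | v ξ < 0} :=
  measurableSet_lt hv.continuous.measurable measurable_const

theorem neg_subset_Icc (hv : RegularDispersion v k C β κ L) :
    {ξ | v ξ < 0} ⊆ Set.Icc (-L) L := by
  intro ξ (hξ : v ξ < 0)
  refine abs_le.1 ?_
  by_contra hc
  have h1 := hv.growth ξ (not_le.1 hc).le ξ (by simp)
  have h2 := hv.rate_pos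
  have : 0 < κ * (1 + |ξ|) ^ β := by positivity
  linarith

theorem volume_neg_lt_top (hv : RegularDispersion v k C β κ L) : volume {ξ | v ξ < 0} < ⊤ :=
  (measure_mono hv.neg_subset_Icc).trans_lt measure_Icc_lt_top

theorem integrable_indicator (hv : RegularDispersion v k C β κ L) :
    Integrable ({ξ | v ξ < 0}.indicator (1 : ℝ → ℝ)) :=
  (integrable_indicator_iff hv.measurableSet_neg).2 
    (integrableOn_const hv.volume_neg_lt_top.ne (C := (1 : ℝ)))

theorem abs_fermiFun_div_sub_indicator_le {T : ℝ} (hT : 0 < T) (ξ : ℝ) :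
    |fermiFun (v ξ / T) - {ξ | v ξ < 0}.indicator (1 : ℝ → ℝ) ξ| ≤ Real.exp (-|v ξ / T|) := by
  have h := abs_fermiFun_sub_indicator_le (v ξ / T)
  have : (Set.Iio (0 : ℝ)).indicator (1 : ℝ → ℝ) (v ξ / T) =
      {ξ | v ξ < 0}.indicator (1 : ℝ → ℝ) ξ := by
    by_cases hv : v ξ < 0
    · rw [Set.indicator_of_mem (by exact div_neg_of_neg_of_pos hv hT),
        Set.indicator_of_mem (by exact hv), Pi.one_apply, Pi.one_apply]
    · rw [Set.indicator_of_notMem, Set.indicator_of_notMem (by exact hv)]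
      simpa using div_nonneg (not_lt.1 hv) hT.le
  rwa [this] at h

theorem measurable_fermiFun_div (hv : RegularDispersion v k C β κ L) (T : ℝ) :
    Measurable fun ξ => fermiFun (v ξ / T) :=
  (continuous_fermiFun.comp (hv.continuous.div_const T)).measurable

/-- The symbol is the indicator of the bounded Fermi sea up to exp(-|v|/T), and subadditivity of the
p-th power treats the two separately. -/
theorem eventually_integrable_rpow (hv : RegularDispersion v k C β κ L) {p : ℝ} (hp : 0 < p)
    (hp1 : p ≤ 1) :
    ∀ᶠ T : ℝ in 𝓝[>] 0, Integrable fun ξ => |fermiFun (v ξ / T)| ^ p := by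
  obtain ⟨C₂, -, h⟩ := hv.exists_lintegral_exp_le hp
  filter_upwards [h, self_mem_nhdsWithin] with T hT hT0
  have hexp : Integrable fun ξ => Real.exp (-p * |v ξ / T|) := by
    refine ⟨(Continuous.aestronglyMeasurable (by have := hv.continuous; fun_prop)), ?_⟩
    rw [hasFiniteIntegral_iff_ofReal (ae_of_all _ fun _ => (Real.exp_pos _).le)]
    exact hT.trans_lt ENNReal.ofReal_lt_top
  refine (hexp.add hv.integrable_indicator).mono'
    ((hv.measurable_fermiFun_div T).abs.pow_const p).aestronglyMeasurable (ae_of_all _ fun ξ => ?_)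
  rw [Real.norm_of_nonneg (by positivity)]
  have h1 := rpow_abs_sub_le hp hp1
    (fermiFun (v ξ / T) - {ξ | v ξ < 0}.indicator (1 : ℝ → ℝ) ξ)
    (-{ξ | v ξ < 0}.indicator (1 : ℝ → ℝ) ξ)
  rw [sub_neg_eq_add, sub_add_cancel] at h1
  refine h1.trans (add_le_add ?_ ?_)
  · show _ ≤ Real.exp (-p * |v ξ / T|)
    rw [show -p * |v ξ / T| = -|v ξ / T| * p by ring, Real.exp_mul]
    exact Real.rpow_le_rpow (abs_nonneg _) (abs_fermiFun_div_sub_indicator_le hT0 ξ) hp.le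
  · by_cases hξ : ξ ∈ {ξ | v ξ < 0}
    · rw [Set.indicator_of_mem hξ]; simp
    · rw [Set.indicator_of_notMem hξ]; simp [Real.zero_rpow hp.ne']

/-- The pointwise majorant carries (d/T)², its η-integral is O(T), and the remaining t-integral is a
beta integral. -/
theorem exists_norm_widomShift_le_of_abs_le (hv : RegularDispersion v k C β κ L)
    (hf : HolderOffPoint f t₀ σ M) :
    ∃ D : ℝ, 0 ≤ D ∧ ∀ᶠ T : ℝ in 𝓝[>] 0, ∀ d : ℝ, |d| ≤ T →
      ‖widomShift (fun ξ => fermiFun (v ξ / T)) f d‖ ≤ D * (d ^ 2 / T) := by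
  obtain ⟨m, C₁, C₂, κ', hC₁, hC₂, hκ', hmaj⟩ := hv.exists_enorm_sub_le hf
  obtain ⟨X, B, hB, htail⟩ := exists_fermiSingularWeight_le hf.exponent_pos hf.exponent_lt t₀
  obtain ⟨D₁, hD₁, hD₁'⟩ := hv.exists_lintegral_comp_div_le
    (lintegral_fermiSingularWeight_lt_top hf.exponent_pos t₀) hf.exponent_pos hB htail (2 * k)
  obtain ⟨D₂, hD₂, hD₂'⟩ := exists_lintegral_pow_mul_exp_neg_div_le hv.exponent_pos hκ' m
  have hβ := betaDiag_nonneg σ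
  refine ⟨betaDiag σ * (C₁ * D₁ + C₂ * D₂), by positivity, ?_⟩
  filter_upwards [hD₁', Ioc_mem_nhdsGT zero_lt_one,
    hv.eventually_integrable_rpow hf.exponent_pos hf.exponent_lt.le] with T hT₁ hT hint d hd
  obtain ⟨hT0, hT1⟩ := hT
  have hG : Measurable fun η => ENNReal.ofReal C₁ *
      (ENNReal.ofReal ((1 + |η|) ^ (2 * k)) * fermiSingularWeight t₀ σ (v η / T)) := by
    have h1 := (measurable_fermiSingularWeight t₀ σ).comp (hv.continuous.div_const T).measurable
    exact ((by fun_prop : Measurable fun η : ℝ => ENNReal.ofReal ((1 + |η|) ^ (2 * k))).mul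
      h1).const_mul _
  have hGi : ∫⁻ η, (ENNReal.ofReal C₁ *
      (ENNReal.ofReal ((1 + |η|) ^ (2 * k)) * fermiSingularWeight t₀ σ (v η / T)) +
      ENNReal.ofReal C₂ *
        ENNReal.ofReal ((1 + |η|) ^ m * Real.exp (-κ' * (1 + |η|) ^ β / T))) ≤
      ENNReal.ofReal ((C₁ * D₁ + C₂ * D₂) * T) := by
    rw [lintegral_add_left hG, lintegral_const_mul' _ _ ENNReal.ofReal_ne_top,
      lintegral_const_mul' _ _ ENNReal.ofReal_ne_top, add_mul,
      ENNReal.ofReal_add (by positivity) (by positivity), mul_assoc, mul_assoc,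
      ENNReal.ofReal_mul hC₁, ENNReal.ofReal_mul hC₂]
    gcongr
    exact hD₂' T hT0 hT1
  have hbound := hf.enorm_widomShift_le (hv.measurable_fermiFun_div T) hint d
  rw [← ofReal_norm] at hbound
  refine (ENNReal.ofReal_le_ofReal_iff (by positivity)).1 (hbound.trans ?_)
  rw [← restrict_Ioo_eq_restrict_Ioc]
  have hinner : ∀ t ∈ Set.Ioo (0 : ℝ) 1, ∫⁻ ξ,
      ‖(f ((1 - t) * fermiFun (v ξ / T) + t * fermiFun (v (ξ + d) / T)) -
        f (fermiFun (v (ξ + t * d) / T))) / ((t : ℂ) * (1 - t))‖ₑ ≤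
      ENNReal.ofReal ((t * (1 - t)) ^ (σ - 1)) *
        ENNReal.ofReal ((d / T) ^ 2 * ((C₁ * D₁ + C₂ * D₂) * T)) := by
    intro t ht
    have htt : 0 < t * (1 - t) := mul_pos ht.1 (by linarith [ht.2])
    -- Recentre at η = ξ + td, the barycentre at which the interpolation estimate is stated.
    rw [← lintegral_sub_right_eq_self _ (t * d)]
    calc _ ≤ ∫⁻ η, ENNReal.ofReal ((t * (1 - t))⁻¹) *
          (ENNReal.ofReal ((t * (1 - t)) ^ σ * (d / T) ^ 2) *
          (ENNReal.ofReal C₁ *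
            (ENNReal.ofReal ((1 + |η|) ^ (2 * k)) * fermiSingularWeight t₀ σ (v η / T)) +
          ENNReal.ofReal C₂ *
            ENNReal.ofReal ((1 + |η|) ^ m * Real.exp (-κ' * (1 + |η|) ^ β / T)))) := by
          refine lintegral_mono fun η => ?_
          have h1 := hmaj T hT0 hT1 d hd t ht η
          rw [show η - t * d + d = η + (1 - t) * d by ring, sub_add_cancel,
            div_eq_mul_inv, enorm_mul, mul_comm]
          gcongr
          rw [← ofReal_norm, norm_inv, show (t : ℂ) * (1 - t) = ((t * (1 - t) : ℝ) : ℂ) by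
            push_cast; ring, Complex.norm_real, Real.norm_of_nonneg htt.le]
      _ ≤ ENNReal.ofReal ((t * (1 - t))⁻¹) * (ENNReal.ofReal ((t * (1 - t)) ^ σ * (d / T) ^ 2) *
          ENNReal.ofReal ((C₁ * D₁ + C₂ * D₂) * T)) := by
          rw [lintegral_const_mul' _ _ ENNReal.ofReal_ne_top,
            lintegral_const_mul' _ _ ENNReal.ofReal_ne_top]
          gcongr
      _ = _ := by
          rw [← ENNReal.ofReal_mul (by positivity), ← ENNReal.ofReal_mul (by positivity),
            ← ENNReal.ofReal_mul (by positivity), Real.rpow_sub_one htt.ne']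
          congr 1
          ring
  calc _ ≤ ∫⁻ t in Set.Ioo (0 : ℝ) 1, ENNReal.ofReal ((t * (1 - t)) ^ (σ - 1)) *
        ENNReal.ofReal ((d / T) ^ 2 * ((C₁ * D₁ + C₂ * D₂) * T)) :=
        setLIntegral_mono' measurableSet_Ioo hinner
    _ = ENNReal.ofReal (betaDiag σ) * ENNReal.ofReal ((d / T) ^ 2 * ((C₁ * D₁ + C₂ * D₂) * T)) := by
        rw [lintegral_mul_const' _ _ ENNReal.ofReal_ne_top, restrict_Ioo_eq_restrict_Ioc,
          lintegral_mul_one_sub_rpow hf.exponent_pos]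
    _ = ENNReal.ofReal (betaDiag σ * (C₁ * D₁ + C₂ * D₂) * (d ^ 2 / T)) := by
        rw [← ENNReal.ofReal_mul hβ]
        congr 1
        field_simp
    _ ≤ _ := le_rfl

/-! ### Comparison with zero temperature -/

/-- The measure of the set of `ξ` such that exactly one of `ξ`, `ξ + d` lies in `{v < 0}`. -/
noncomputable def crossing (v : ℝ → ℝ) (d : ℝ) : ℝ :=
  ∫ ξ, |{ξ | v ξ < 0}.indicator (1 : ℝ → ℝ) ξ - {ξ | v ξ < 0}.indicator (1 : ℝ → ℝ) (ξ + d)|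

theorem integrable_crossing (hv : RegularDispersion v k C β κ L) (d : ℝ) :
    Integrable fun ξ => |{ξ | v ξ < 0}.indicator (1 : ℝ → ℝ) ξ -
      {ξ | v ξ < 0}.indicator (1 : ℝ → ℝ) (ξ + d)| :=
  (hv.integrable_indicator.sub (hv.integrable_indicator.comp_add_right d)).abs

theorem crossing_nonneg (v : ℝ → ℝ) (d : ℝ) : 0 ≤ crossing v d :=
  integral_nonneg fun _ => abs_nonneg _

theorem crossing_le (hv : RegularDispersion v k C β κ L) (d : ℝ) :
    crossing v d ≤ 2 * ∫ ξ, {ξ | v ξ < 0}.indicator (1 : ℝ → ℝ) ξ := by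
  have h1 := hv.integrable_indicator
  have h2 := h1.comp_add_right d
  calc crossing v d ≤ ∫ ξ, ({ξ | v ξ < 0}.indicator (1 : ℝ → ℝ) ξ +
        {ξ | v ξ < 0}.indicator (1 : ℝ → ℝ) (ξ + d)) := by
        refine integral_mono (hv.integrable_crossing d) (h1.add h2) fun ξ => ?_
        have e : ∀ x, 0 ≤ {ξ | v ξ < 0}.indicator (1 : ℝ → ℝ) x := fun x =>
          Set.indicator_nonneg (fun _ _ => zero_le_one) x
        have e1 := e ξ
        have e2 := e (ξ + d)
        show |_ - _| ≤ _ + _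
        rw [abs_le]; constructor <;> linarith
    _ = _ := by
        rw [integral_add h1 h2, integral_add_right_eq_self
          ({ξ | v ξ < 0}.indicator (1 : ℝ → ℝ))]
        ring

theorem widomU_indicator (f : ℝ → ℂ) (S : Set ℝ) (ξ η : ℝ) :
    widomU (S.indicator 1 ξ) (S.indicator 1 η) f =
      widomU 1 0 f * (|S.indicator (1 : ℝ → ℝ) ξ - S.indicator 1 η| : ℝ) := by
  by_cases h1 : ξ ∈ S <;> by_cases h2 : η ∈ S <;>
    simp [h1, h2, widomU_self, widomU_comm 0 1]

/-- Replacing the symbol by the indicator changes U by at most a multiple of the (σ/2)-th powers of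
the errors at ξ and ξ + d. These powers decay exponentially in |v|/T and so integrate to O(T);
translation invariance makes the bound uniform in d. -/
theorem exists_norm_widomShift_sub_le (hv : RegularDispersion v k C β κ L)
    (hf : HolderOffPoint f t₀ σ M) :
    ∃ D : ℝ, 0 ≤ D ∧ ∀ᶠ T : ℝ in 𝓝[>] 0, ∀ d : ℝ,
      ‖widomShift (fun ξ => fermiFun (v ξ / T)) f d - widomU 1 0 f * (crossing v d : ℝ)‖ ≤
        D * T := by
  have hσ2 : 0 < σ / 2 := half_pos hf.exponent_pos
  obtain ⟨D, hD, hexp⟩ := hv.exists_lintegral_exp_le hσ2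
  have hM := hf.const_nonneg
  have hβ := betaDiag_nonneg (σ / 2)
  set B := 3 * M * betaDiag (σ / 2) with hB
  have hB0 : 0 ≤ B := by positivity
  refine ⟨B * (2 * D), by positivity, ?_⟩
  filter_upwards [hexp, self_mem_nhdsWithin,
    hv.eventually_integrable_rpow hf.exponent_pos hf.exponent_lt.le] with T hT hT0 hint d
  rw [Set.mem_Ioi] at hT0
  set χ := {ξ | v ξ < 0}.indicator (1 : ℝ → ℝ) with hχ
  set e : ℝ → ℝ := fun ξ => Real.exp (-(σ / 2) * |v ξ / T|) with he
  have hem : Integrable e := by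
    refine ⟨(Continuous.aestronglyMeasurable (by have := hv.continuous; fun_prop)), ?_⟩
    rw [hasFiniteIntegral_iff_ofReal (ae_of_all _ fun _ => (Real.exp_pos _).le)]
    exact hT.trans_lt ENNReal.ofReal_lt_top
  have hei : ∫ ξ, e ξ ≤ D * T := by
    rw [integral_eq_lintegral_of_nonneg_ae (ae_of_all _ fun _ => (Real.exp_pos _).le)
      hem.aestronglyMeasurable]
    exact ENNReal.toReal_le_of_le_ofReal (by positivity) hT
  have hχ01 : ∀ ξ, 0 ≤ χ ξ ∧ χ ξ ≤ 1 := by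
    intro ξ
    by_cases hξ : ξ ∈ {ξ | v ξ < 0}
    · rw [hχ, Set.indicator_of_mem hξ]; simp
    · rw [hχ, Set.indicator_of_notMem hξ]; simp
  have h0 : widomU 1 0 f * (crossing v d : ℝ) = ∫ ξ, widomU (χ ξ) (χ (ξ + d)) f := by
    have h2 : ((crossing v d : ℝ) : ℂ) = ∫ ξ, ((|χ ξ - χ (ξ + d)| : ℝ) : ℂ) :=
      integral_ofReal.symm
    rw [h2, ← integral_const_mul]
    exact integral_congr_ae (ae_of_all _ fun ξ => (widomU_indicator f _ ξ (ξ + d)).symm)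
  have h1 : Integrable fun ξ => widomU (χ ξ) (χ (ξ + d)) f := by
    have h2 := ((hv.integrable_crossing d).ofReal (𝕜 := ℂ)).const_mul (widomU 1 0 f)
    exact h2.congr (ae_of_all _ fun ξ => (widomU_indicator f _ ξ (ξ + d)).symm)
  rw [h0, widomShift, ← integral_sub
    (hf.integrable_widomU_shift (hv.measurable_fermiFun_div T) hint d) h1]
  have hpt : ∀ ξ, |fermiFun (v ξ / T) - χ ξ| ^ (σ / 2) ≤ e ξ := by
    intro ξ
    rw [he]
    simp only
    rw [show -(σ / 2) * |v ξ / T| = -|v ξ / T| * (σ / 2) by ring, Real.exp_mul]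
    exact Real.rpow_le_rpow (abs_nonneg _) (abs_fermiFun_div_sub_indicator_le hT0 ξ) hσ2.le
  have hi2 : Integrable fun ξ => B * (e ξ + e (ξ + d)) :=
    (hem.add (hem.comp_add_right d)).const_mul B
  refine (norm_integral_le_of_norm_le hi2 (ae_of_all _ fun ξ => ?_)).trans ?_
  · refine (hf.norm_widomU_sub_le ?_ ?_).trans ?_
    · rw [abs_le]
      constructor <;> linarith [fermiFun_pos (v ξ / T), fermiFun_lt_one (v ξ / T),
        fermiFun_pos (v (ξ + d) / T), fermiFun_lt_one (v (ξ + d) / T)]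
    · rw [abs_le]
      constructor <;> linarith [(hχ01 ξ).1, (hχ01 ξ).2, (hχ01 (ξ + d)).1, (hχ01 (ξ + d)).2]
    · exact mul_le_mul_of_nonneg_left (add_le_add (hpt ξ) (hpt (ξ + d))) hB0
  · rw [integral_const_mul, integral_add hem (hem.comp_add_right d),
      integral_add_right_eq_self e]
    calc B * ((∫ ξ, e ξ) + ∫ ξ, e ξ) ≤ B * (D * T + D * T) := by gcongr
      _ = _ := by ring

end RegularDispersion

/-! ### Components of the Fermi sea and the crossing measure -/

theorem exists_Ioo_connectedComponents {Ω : Set ℝ} (ho : IsOpen Ω) (hb : BddBelow Ω)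
    (ha : BddAbove Ω) :
    ∃ α β : ConnectedComponents Ω → ℝ, (∀ c, α c < β c) ∧ (∀ c, α c ∉ Ω) ∧ (∀ c, β c ∉ Ω) ∧
      (∀ c, Set.Ioo (α c) (β c) ⊆ Ω) ∧ (∀ x ∈ Ω, ∃ c, x ∈ Set.Ioo (α c) (β c)) ∧
      ∀ c c' x, x ∈ Set.Ioo (α c) (β c) → x ∈ Set.Ioo (α c') (β c') → c = c' := by
  set I : Ω → Set ℝ := fun x => connectedComponentIn Ω x with hI
  have hopen : ∀ x, IsOpen (I x) := fun x => ho.connectedComponentIn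
  have hconn : ∀ x, IsConnected (I x) := fun x =>
    isConnected_connectedComponentIn_iff.2 x.2
  have hsub : ∀ x, I x ⊆ Ω := fun x => connectedComponentIn_subset Ω x
  have hInf : ∀ x, sInf (I x) ∉ Ω := by
    intro x hx
    have hcl : sInf (I x) ∈ closure (I x) :=
      csInf_mem_closure (hconn x).nonempty (hb.mono (hsub x))
    -- If the infimum were in Ω, its own open component would meet, hence equal, I x, which would
    -- then extend below its infimum.
    obtain ⟨y, hy1, hy2⟩ := mem_closure_iff.1 hcl (I ⟨_, hx⟩) (hopen _)
      (mem_connectedComponentIn hx)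
    have heq : I ⟨_, hx⟩ = I x :=
      (connectedComponentIn_eq hy1).trans (connectedComponentIn_eq hy2).symm
    have hmem : sInf (I x) ∈ I ⟨sInf (I x), hx⟩ := mem_connectedComponentIn hx
    rw [heq] at hmem
    obtain ⟨l, hl, hls⟩ := exists_Ioc_subset_of_mem_nhds ((hopen x).mem_nhds hmem) (exists_lt _)
    have hm : (l + sInf (I x)) / 2 ∈ I x := hls ⟨by linarith, by linarith⟩
    linarith [csInf_le (hb.mono (hsub x)) hm]
  have hSup : ∀ x, sSup (I x) ∉ Ω := by
    intro x hx
    have hcl : sSup (I x) ∈ closure (I x) :=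
      csSup_mem_closure (hconn x).nonempty (ha.mono (hsub x))
    obtain ⟨y, hy1, hy2⟩ := mem_closure_iff.1 hcl (I ⟨_, hx⟩) (hopen _)
      (mem_connectedComponentIn hx)
    have heq : I ⟨_, hx⟩ = I x :=
      (connectedComponentIn_eq hy1).trans (connectedComponentIn_eq hy2).symm
    have hmem : sSup (I x) ∈ I ⟨sSup (I x), hx⟩ := mem_connectedComponentIn hx
    rw [heq] at hmem
    obtain ⟨l, hl, hls⟩ := exists_Ico_subset_of_mem_nhds ((hopen x).mem_nhds hmem) (exists_gt _)
    have hm : (l + sSup (I x)) / 2 ∈ I x := hls ⟨by linarith, by linarith⟩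
    linarith [le_csSup (ha.mono (hsub x)) hm]
  have hIoo : ∀ x, I x = Set.Ioo (sInf (I x)) (sSup (I x)) := by
    intro x
    refine Set.Subset.antisymm (fun y hy => ⟨?_, ?_⟩)
      ((hconn x).Ioo_csInf_csSup_subset (hb.mono (hsub x)) (ha.mono (hsub x)))
    · refine lt_of_le_of_ne (csInf_le (hb.mono (hsub x)) hy) fun h => hInf x ?_
      rw [h]; exact hsub x hy
    · refine lt_of_le_of_ne (le_csSup (ha.mono (hsub x)) hy) fun h => hSup x ?_
      rw [← h]; exact hsub x hy
  have hmk : ∀ x y : Ω, (y : ℝ) ∈ I x ↔ (ConnectedComponents.mk y) = ConnectedComponents.mk x := by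
    intro x y
    rw [ConnectedComponents.coe_eq_coe']
    simp only [hI]
    rw [connectedComponentIn_eq_image x.2]
    constructor
    · rintro ⟨z, hz, hzy⟩
      rwa [Subtype.ext hzy] at hz
    · intro hy
      exact ⟨y, hy, rfl⟩
  choose r hr using ConnectedComponents.surjective_coe (α := Ω)
  refine ⟨fun c => sInf (I (r c)), fun c => sSup (I (r c)), fun c => ?_, fun c => hInf _,
    fun c => hSup _, fun c => ?_, fun x hx => ?_, fun c c' x h1 h2 => ?_⟩
  · have hm : (r c : ℝ) ∈ I (r c) := mem_connectedComponentIn (r c).2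
    rw [hIoo] at hm
    exact hm.1.trans hm.2
  · rw [← hIoo]; exact hsub _
  · refine ⟨ConnectedComponents.mk ⟨x, hx⟩, ?_⟩
    rw [← hIoo]
    exact (hmk _ ⟨x, hx⟩).2 (hr _).symm
  · rw [← hIoo] at h1 h2
    have hx := hsub _ h1
    rw [← hr c, ← hr c', ← (hmk _ ⟨x, hx⟩).1 h1, ← (hmk _ ⟨x, hx⟩).1 h2]

/-- For 0 ≤ d < β - α the integrand is the indicator of two intervals of length d, one at each end;
negative d reduces to this by translation. -/
theorem integral_abs_indicator_Ioo_sub {α β d : ℝ} (hd : |d| < β - α) :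
    ∫ ξ, |(Set.Ioo α β).indicator (1 : ℝ → ℝ) ξ - (Set.Ioo α β).indicator 1 (ξ + d)| =
      2 * |d| := by
  have main : ∀ d, 0 ≤ d → d < β - α →
      ∫ ξ, |(Set.Ioo α β).indicator (1 : ℝ → ℝ) ξ - (Set.Ioo α β).indicator 1 (ξ + d)| =
        2 * d := by
    intro d hd0 hd
    have e : (fun ξ => |(Set.Ioo α β).indicator (1 : ℝ → ℝ) ξ -
        (Set.Ioo α β).indicator 1 (ξ + d)|) = fun ξ =>
        (Set.Ioc (α - d) α).indicator (1 : ℝ → ℝ) ξ + (Set.Ico (β - d) β).indicator 1 ξ := by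
      ext ξ
      simp only [Set.indicator_apply, Set.mem_Ioo, Set.mem_Ioc, Set.mem_Ico, Pi.one_apply]
      split_ifs with h1 h2 h3 h4 h3 h4 h2 h3 h4 h3 h4 <;> simp <;> grind
    have i1 : Integrable ((Set.Ioc (α - d) α).indicator (1 : ℝ → ℝ)) :=
      (integrable_indicator_iff measurableSet_Ioc).2
        (integrableOn_const measure_Ioc_lt_top.ne (C := (1 : ℝ)))
    have i2 : Integrable ((Set.Ico (β - d) β).indicator (1 : ℝ → ℝ)) :=
      (integrable_indicator_iff measurableSet_Ico).2
        (integrableOn_const measure_Ico_lt_top.ne (C := (1 : ℝ)))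
    rw [e, integral_add i1 i2, integral_indicator_one measurableSet_Ioc,
      integral_indicator_one measurableSet_Ico, Real.volume_real_Ioc_of_le (by linarith),
      Real.volume_real_Ico_of_le (by linarith)]
    ring
  rcases abs_choice d with h | h
  · rw [h] at hd ⊢
    exact main d (h ▸ abs_nonneg d) hd
  · rw [h] at hd ⊢
    rw [← main (-d) (h ▸ abs_nonneg d) hd, ← integral_add_right_eq_self (fun ξ =>
      |(Set.Ioo α β).indicator (1 : ℝ → ℝ) ξ - (Set.Ioo α β).indicator 1 (ξ + d)|) (-d)]
    simp only [neg_add_cancel_right, abs_sub_comm]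

namespace RegularDispersion

variable {v : ℝ → ℝ} {k : ℕ} {C β κ L : ℝ}

/-- Distinct components have no common endpoint: v would have a local maximum there with value 0,
against nondegeneracy. Finitely many positive gaps and lengths then allow a common smallness of d
for which no shift jumps between components, and the contributions 2|d| add up. -/
theorem eventually_crossing_eq (hv : RegularDispersion v k C β κ L)
    (hfin : Finite (ConnectedComponents {ξ | v ξ < 0})) :
    ∀ᶠ d in 𝓝 (0 : ℝ), crossing v d = 2 * Nat.card (ConnectedComponents {ξ | v ξ < 0}) * |d| := by
  set Ω := {ξ | v ξ < 0} with hΩ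
  have ho : IsOpen Ω := isOpen_lt hv.continuous continuous_const
  have hbd := hv.neg_subset_Icc
  obtain ⟨α, β, hαβ, hα, hβ, hsub, hcov, huniq⟩ := exists_Ioo_connectedComponents ho
    (bddBelow_Icc.mono hbd) (bddAbove_Icc.mono hbd)
  have hne : ∀ c c', β c ≠ α c' := by
    intro c c' h
    have hz0 : 0 ≤ v (β c) := not_lt.1 (hβ c)
    have hle : v (β c) ≤ 0 := by
      have hcl : β c ∈ closure (Set.Ioo (α c) (β c)) := by
        rw [closure_Ioo (hαβ c).ne]; exact ⟨(hαβ c).le, le_rfl⟩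
      exact closure_minimal (fun x hx => (show v x < 0 from hsub c hx).le)
        (isClosed_le hv.continuous continuous_const) hcl
    refine hv.nondegenerate _ (le_antisymm hle hz0) (IsLocalMax.deriv_eq_zero ?_)
    have h2 : β c < β c' := h ▸ hαβ c'
    filter_upwards [Ioo_mem_nhds (hαβ c) h2] with x hx
    rcases lt_trichotomy x (β c) with h3 | h3 | h3
    · exact (show v x < 0 from hsub c ⟨hx.1, h3⟩).le.trans hz0
    · rw [h3]
    · exact (show v x < 0 from hsub c' ⟨h ▸ h3, hx.2⟩).le.trans hz0
  have hsmall : ∀ r : ℝ, 0 < r → ∀ᶠ d in 𝓝 (0 : ℝ), |d| < r := fun r hr => by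
    have := continuous_abs.tendsto (0 : ℝ)
    rw [abs_zero] at this
    exact this.eventually_lt_const hr
  have hgap : ∀ c c', c ≠ c' → ∀ᶠ d in 𝓝 (0 : ℝ), ∀ ξ, ξ ∈ Set.Ioo (α c) (β c) →
      ξ + d ∉ Set.Ioo (α c') (β c') := by
    intro c c' hcc
    have hsep : β c ≤ α c' ∨ β c' ≤ α c := by
      by_contra hcon
      push Not at hcon
      have hlt : max (α c) (α c') < min (β c) (β c') :=
        max_lt (lt_min (hαβ c) hcon.2) (lt_min hcon.1 (hαβ c'))
      obtain ⟨x, hx1, hx2⟩ := exists_between hlt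
      exact hcc (huniq c c' x ⟨(le_max_left _ _).trans_lt hx1, hx2.trans_le (min_le_left _ _)⟩
        ⟨(le_max_right _ _).trans_lt hx1, hx2.trans_le (min_le_right _ _)⟩)
    rcases hsep with h | h
    · filter_upwards [hsmall (α c' - β c) (sub_pos.2 (lt_of_le_of_ne h (hne c c')))]
        with d hd ξ hξ hξ'
      linarith [le_abs_self d, hξ.2, hξ'.1]
    · filter_upwards [hsmall (α c - β c') (sub_pos.2 (lt_of_le_of_ne h (hne c' c)))]
        with d hd ξ hξ hξ'
      linarith [neg_abs_le d, hξ.1, hξ'.2]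
  have hgap' : ∀ᶠ d in 𝓝 (0 : ℝ), ∀ c c', c ≠ c' → ∀ ξ, ξ ∈ Set.Ioo (α c) (β c) →
      ξ + d ∉ Set.Ioo (α c') (β c') := by
    rw [eventually_all]; intro c
    rw [eventually_all]; intro c'
    by_cases h : c = c'
    · exact Eventually.of_forall fun d hcc => absurd h hcc
    · exact (hgap c c' h).mono fun d hd _ => hd
  have hlen : ∀ᶠ d in 𝓝 (0 : ℝ), ∀ c, |d| < β c - α c := by
    rw [eventually_all]; exact fun c => hsmall _ (sub_pos.2 (hαβ c))
  filter_upwards [hgap', hlen] with d hd hld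
  have := Fintype.ofFinite (ConnectedComponents Ω)
  have hone : ∀ c x, x ∈ Set.Ioo (α c) (β c) →
      Ω.indicator (1 : ℝ → ℝ) x = (Set.Ioo (α c) (β c)).indicator 1 x := by
    intro c x hx
    rw [Set.indicator_of_mem hx, Set.indicator_of_mem (hsub c hx)]
  have hpt : ∀ ξ, |Ω.indicator (1 : ℝ → ℝ) ξ - Ω.indicator (1 : ℝ → ℝ) (ξ + d)| =
      ∑ c, |(Set.Ioo (α c) (β c)).indicator (1 : ℝ → ℝ) ξ -
        (Set.Ioo (α c) (β c)).indicator 1 (ξ + d)| := by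
    intro ξ
    by_cases h1 : ξ ∈ Ω
    · obtain ⟨c, hc⟩ := hcov ξ h1
      rw [Finset.sum_eq_single c, hone c ξ hc]
      · congr 2
        by_cases h2 : ξ + d ∈ Ω
        · obtain ⟨c', hc'⟩ := hcov _ h2
          have : c = c' := by by_contra hcc; exact hd c c' hcc ξ hc hc'
          rw [this]
          exact hone c' _ hc'
        · rw [Set.indicator_of_notMem h2, Set.indicator_of_notMem fun h => h2 (hsub c h)]
      · intro c' _ hcc
        rw [Set.indicator_of_notMem fun h => hcc (huniq _ _ _ h hc),
          Set.indicator_of_notMem (hd c c' (Ne.symm hcc) ξ hc)]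
        simp
      · simp
    · by_cases h2 : ξ + d ∈ Ω
      · obtain ⟨c, hc⟩ := hcov _ h2
        rw [Finset.sum_eq_single c, hone c _ hc, Set.indicator_of_notMem h1,
          Set.indicator_of_notMem fun h => h1 (hsub c h)]
        · intro c' _ hcc
          rw [Set.indicator_of_notMem fun h => h1 (hsub c' h),
            Set.indicator_of_notMem fun h => hcc (huniq _ _ _ h hc)]
          simp
        · simp
      · rw [Set.indicator_of_notMem h1, Set.indicator_of_notMem h2, sub_zero, abs_zero]
        refine (Finset.sum_eq_zero fun c _ => ?_).symm
        rw [Set.indicator_of_notMem fun h => h1 (hsub c h),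
          Set.indicator_of_notMem fun h => h2 (hsub c h)]
        simp
  rw [crossing]
  simp only [← hΩ, hpt]
  rw [integral_finsetSum]
  · simp only [integral_abs_indicator_Ioo_sub (hld _), Finset.sum_const, Finset.card_univ,
      nsmul_eq_mul, Nat.card_eq_fintype_card]
    ring
  · intro c _
    have h1 : Integrable ((Set.Ioo (α c) (β c)).indicator (1 : ℝ → ℝ)) :=
      (integrable_indicator_iff measurableSet_Ioo).2
        (integrableOn_const measure_Ioo_lt_top.ne (C := (1 : ℝ)))
    exact (h1.sub (h1.comp_add_right d)).abs

end RegularDispersion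

/-! ### Extraction of the logarithm -/

theorem integral_indicator_Ioi_abs {r : ℝ} (hr : 0 < r) :
    ∫ d : ℝ, (Set.Ioi r).indicator (fun y => y ^ (-2 : ℝ)) |d| = 2 / r := by
  rw [integral_comp_abs (f := (Set.Ioi r).indicator (fun y => y ^ (-2 : ℝ))),
    setIntegral_indicator measurableSet_Ioi, Set.inter_eq_right.2 (Set.Ioi_subset_Ioi hr.le),
    integral_Ioi_rpow_of_lt (by norm_num) hr]
  rw [show (-2 : ℝ) + 1 = -1 by norm_num, Real.rpow_neg_one]
  field_simp

/-- The Bochner integral of a non-integrable function is 0, so the nonzero value already found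
proves integrability. -/
theorem integrable_indicator_Ioi_abs {r : ℝ} (hr : 0 < r) :
    Integrable fun d : ℝ => (Set.Ioi r).indicator (fun y => y ^ (-2 : ℝ)) |d| := by
  refine Integrable.of_integral_ne_zero ?_
  rw [integral_indicator_Ioi_abs hr]
  positivity

theorem integral_indicator_Ioc_abs {T r : ℝ} (hT : 0 < T) (hTr : T < r) :
    ∫ d : ℝ, (Set.Ioc T r).indicator (fun y => y⁻¹) |d| = 2 * Real.log (r / T) := by
  rw [integral_comp_abs (f := (Set.Ioc T r).indicator (fun y => y⁻¹)),
    setIntegral_indicator measurableSet_Ioc,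
    Set.inter_eq_right.2 (Set.Ioc_subset_Ioi_self.trans (Set.Ioi_subset_Ioi hT.le)),
    ← intervalIntegral.integral_of_le hTr.le, integral_inv_of_pos hT (hT.trans hTr)]

theorem integrable_indicator_Ioc_abs {T r : ℝ} (hT : 0 < T) (hTr : T < r) :
    Integrable fun d : ℝ => (Set.Ioc T r).indicator (fun y => y⁻¹) |d| := by
  refine Integrable.of_integral_ne_zero ?_
  rw [integral_indicator_Ioc_abs hT hTr]
  have := Real.log_pos ((one_lt_div hT).2 hTr)
  positivity

/-- After division by d², the three bounds become C₁/T on |d| ≤ T, an error C₂T/d² around A/|d| on T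
< |d| ≤ r, and C₃/d² beyond. The errors integrate to 2C₁, at most 2C₂, and 2C₃/r, while A/|d| gives
2A log(r/T). -/
theorem integrable_div_sq_and_norm_integral_sub_log_le {J : ℝ → ℂ} (hJ : Measurable J) {A : ℂ}
    {T r C₁ C₂ C₃ : ℝ} (hT : 0 < T) (hT1 : T ≤ 1) (hTr : T < r) (hC₂ : 0 ≤ C₂)
    (h₁ : ∀ d, |d| ≤ T → ‖J d‖ ≤ C₁ * (d ^ 2 / T))
    (h₂ : ∀ d, |d| ≤ r → ‖J d - A * (|d| : ℝ)‖ ≤ C₂ * T) (h₃ : ∀ d, ‖J d‖ ≤ C₃) :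
    Integrable (fun d => J d / ((|d| ^ 2 : ℝ) : ℂ)) ∧
      ‖(∫ d, J d / ((|d| ^ 2 : ℝ) : ℂ)) - 2 * A * (|Real.log T| : ℝ)‖ ≤
        2 * C₁ + 2 * C₂ + 2 * C₃ / r + 2 * ‖A‖ * |Real.log r| := by
  have hr : 0 < r := hT.trans hTr
  have hC₁ : 0 ≤ C₁ := by
    have := (norm_nonneg _).trans (h₁ T (by rw [abs_of_pos hT]))
    exact nonneg_of_mul_nonneg_left this (by positivity)
  have hC₃ : 0 ≤ C₃ := (norm_nonneg _).trans (h₃ 0)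
  set g : ℝ → ℂ := fun d => J d / ((|d| ^ 2 : ℝ) : ℂ) with hg
  set l : ℝ → ℝ := fun d => (Set.Ioc T r).indicator (fun y => y⁻¹) |d| with hl
  set b₁ : ℝ → ℝ := (Set.Icc (-T) T).indicator (fun _ => 1) with hb₁
  set b₂ : ℝ → ℝ := fun d => (Set.Ioi T).indicator (fun y => y ^ (-2 : ℝ)) |d| with hb₂
  set b₃ : ℝ → ℝ := fun d => (Set.Ioi r).indicator (fun y => y ^ (-2 : ℝ)) |d| with hb₃
  have il : Integrable l := integrable_indicator_Ioc_abs hT hTr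
  have i₁ : Integrable b₁ := (integrable_indicator_iff measurableSet_Icc).2
    (integrableOn_const measure_Icc_lt_top.ne)
  have i₂ : Integrable b₂ := integrable_indicator_Ioi_abs hT
  have i₃ : Integrable b₃ := integrable_indicator_Ioi_abs hr
  have hgm : Measurable g := hJ.div (by fun_prop)
  set B : ℝ → ℝ := fun d => C₁ / T * b₁ d + C₂ * T * b₂ d + C₃ * b₃ d with hB
  have iB : Integrable B := ((i₁.const_mul _).add (i₂.const_mul _)).add (i₃.const_mul _)
  have ilA : Integrable fun d => A * ((l d : ℝ) : ℂ) := (il.ofReal).const_mul A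
  have hpt : ∀ d, ‖g d - A * ((l d : ℝ) : ℂ)‖ ≤ B d := by
    intro d
    have hng : ‖g d‖ = ‖J d‖ / |d| ^ 2 := by
      rw [hg]
      simp only
      rw [norm_div, Complex.norm_real, Real.norm_of_nonneg (by positivity)]
    have n₂ : 0 ≤ b₂ d := Set.indicator_nonneg (fun y hy => by
      have : (0 : ℝ) < y := hT.trans hy
      positivity) _
    have n₃ : 0 ≤ b₃ d := Set.indicator_nonneg (fun y hy => by
      have : (0 : ℝ) < y := hr.trans hy
      positivity) _
    have n₁ : 0 ≤ b₁ d := Set.indicator_nonneg (fun _ _ => zero_le_one) _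
    rcases le_or_gt |d| T with hd | hd
    · have e1 : l d = 0 := Set.indicator_of_notMem (fun h => not_lt.2 hd h.1) _
      have e2 : b₁ d = 1 := Set.indicator_of_mem (show d ∈ Set.Icc (-T) T from abs_le.1 hd) _
      rw [e1, Complex.ofReal_zero, mul_zero, sub_zero, hng]
      have : ‖J d‖ / |d| ^ 2 ≤ C₁ / T := by
        rw [sq_abs]
        refine div_le_of_le_mul₀ (by positivity) (by positivity) ((h₁ d hd).trans_eq ?_)
        ring
      simp only [hB, e2]
      have p2 : 0 ≤ C₂ * T * b₂ d := by positivity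
      have p3 : 0 ≤ C₃ * b₃ d := by positivity
      linarith
    · have hd0 : 0 < |d| := hT.trans hd
      have p1 : 0 ≤ C₁ / T * b₁ d := by positivity
      have hinv : |d| ^ (-2 : ℝ) = (|d| ^ 2)⁻¹ := by
        rw [Real.rpow_neg hd0.le, Real.rpow_two]
      have e2 : b₂ d = (|d| ^ 2)⁻¹ := (Set.indicator_of_mem (by exact hd) _).trans hinv
      rcases le_or_gt |d| r with hdr | hdr
      · have e1 : l d = |d|⁻¹ := Set.indicator_of_mem (by exact ⟨hd, hdr⟩) _
        have e3 : g d - A * ((l d : ℝ) : ℂ) = (J d - A * (|d| : ℝ)) / ((|d| ^ 2 : ℝ) : ℂ) := by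
          rw [hg, e1]
          have : ((|d| : ℝ) : ℂ) ≠ 0 := by exact_mod_cast hd0.ne'
          push_cast
          field_simp
        rw [e3, norm_div, Complex.norm_real, Real.norm_of_nonneg (by positivity), div_eq_mul_inv]
        have := mul_le_mul_of_nonneg_right (h₂ d hdr) (by positivity : 0 ≤ (|d| ^ 2)⁻¹)
        simp only [hB, e2]
        have p3 : 0 ≤ C₃ * b₃ d := by positivity
        linarith
      · have e1 : l d = 0 := Set.indicator_of_notMem (fun h => not_lt.2 h.2 hdr) _
        have e3 : b₃ d = (|d| ^ 2)⁻¹ := (Set.indicator_of_mem (by exact hdr) _).trans hinv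
        rw [e1, Complex.ofReal_zero, mul_zero, sub_zero, hng, div_eq_mul_inv]
        have := mul_le_mul_of_nonneg_right (h₃ d) (by positivity : 0 ≤ (|d| ^ 2)⁻¹)
        simp only [hB, e3]
        have p2 : 0 ≤ C₂ * T * b₂ d := by positivity
        linarith
  have idiff : Integrable fun d => g d - A * ((l d : ℝ) : ℂ) :=
    iB.mono' (hgm.aestronglyMeasurable.sub ilA.aestronglyMeasurable) (ae_of_all _ hpt)
  have ig : Integrable g := by
    refine (idiff.add ilA).congr (ae_of_all _ fun d => ?_)
    simp
  refine ⟨ig, ?_⟩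
  have hnorm := norm_integral_le_of_norm_le iB (ae_of_all _ hpt)
  have hBint : ∫ d, B d = 2 * C₁ + 2 * C₂ + 2 * C₃ / r := by
    have e₁ : ∫ d, b₁ d = 2 * T := by
      have := integral_indicator_one (μ := (volume : Measure ℝ)) (measurableSet_Icc (a := -T) (b := T))
      rw [Real.volume_real_Icc_of_le (by linarith)] at this
      refine Eq.trans this ?_
      ring
    have e₂ : ∫ d, b₂ d = 2 / T := integral_indicator_Ioi_abs hT
    have e₃ : ∫ d, b₃ d = 2 / r := integral_indicator_Ioi_abs hr
    rw [hB, integral_add (f := fun d => C₁ / T * b₁ d + C₂ * T * b₂ d)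
      ((i₁.const_mul _).add (i₂.const_mul _)) (i₃.const_mul _),
      integral_add (i₁.const_mul _) (i₂.const_mul _), integral_const_mul, integral_const_mul,
      integral_const_mul, e₁, e₂, e₃]
    field_simp
  have hlint : ∫ d, A * ((l d : ℝ) : ℂ) = 2 * A * (Real.log (r / T) : ℝ) := by
    have h4 : ∫ d, ((l d : ℝ) : ℂ) = ((∫ d, l d : ℝ) : ℂ) := integral_ofReal
    rw [integral_const_mul, h4, integral_indicator_Ioc_abs hT hTr]
    push_cast
    ring
  rw [integral_sub ig ilA, hlint, hBint, Real.log_div hr.ne' hT.ne'] at hnorm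
  have habs : |Real.log T| = -Real.log T := abs_of_nonpos (Real.log_nonpos hT.le hT1)
  rw [habs]
  have e : (∫ d, g d) - 2 * A * ((-Real.log T : ℝ) : ℂ) =
      ((∫ d, g d) - 2 * A * ((Real.log r - Real.log T : ℝ) : ℂ)) + 2 * A * (Real.log r : ℝ) := by
    push_cast; ring
  rw [e]
  refine (norm_add_le _ _).trans (add_le_add hnorm ?_)
  rw [norm_mul, norm_mul, Complex.norm_real, Real.norm_eq_abs]
  simp

/-! ### Reduction of the double integral and conclusion -/

theorem measurable_widomShift {f : ℝ → ℂ} {a : ℝ → ℝ} (hf : Continuous f) (ha : Measurable a) :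
    Measurable (widomShift a f) := by
  have h1 : Measurable fun p : ℝ × ℝ => (a p.2, a (p.2 + p.1)) :=
    (ha.comp measurable_snd).prodMk (ha.comp (measurable_snd.add measurable_fst))
  have h2 := (measurable_widomU hf).comp h1
  exact (StronglyMeasurable.integral_prod_right (f := fun (d ξ : ℝ) =>
    widomU (a ξ) (a (ξ + d)) f) h2.stronglyMeasurable).measurable

namespace HolderOffPoint

variable {f : ℝ → ℂ} {t₀ σ M : ℝ} {a : ℝ → ℝ}

/-- The shear (ξ, d) ↦ (ξ, ξ + d) preserves measure and carries the truncation to |d| > ε, where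
1/d² is integrable; the Hölder bound on U justifies Fubini. -/
theorem widomTruncated_eq (hf : HolderOffPoint f t₀ σ M) (ha : Measurable a)
    (hi : Integrable fun ξ => |a ξ| ^ σ) {ε : ℝ} (hε : 0 < ε) :
    IntegrableOn (widomKernel a f) {p : ℝ × ℝ | ε < |p.1 - p.2|} ∧
      widomTruncated a f ε =
        ∫ d in {d : ℝ | ε < |d|}, widomShift a f d / ((|d| ^ 2 : ℝ) : ℂ) := by
  set D : Set ℝ := {d | ε < |d|} with hD
  have hDm : MeasurableSet D := measurableSet_lt measurable_const (by fun_prop)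
  set S : Set (ℝ × ℝ) := {p | ε < |p.1 - p.2|} with hS
  have hmp : MeasurePreserving (MeasurableEquiv.shearAddRight ℝ)
      ((volume : Measure ℝ).prod volume) (volume.prod volume) :=
    measurePreserving_prod_add volume volume
  have hemb := (MeasurableEquiv.shearAddRight ℝ).measurableEmbedding
  have hpre : (MeasurableEquiv.shearAddRight ℝ) ⁻¹' S = Set.univ ×ˢ D := by
    ext ⟨ξ, d⟩
    show ε < |ξ - (ξ + d)| ↔ _
    simp [hD]
  set G : ℝ × ℝ → ℂ := fun p => widomU (a p.1) (a (p.1 + p.2)) f / ((|p.2| ^ 2 : ℝ) : ℂ) with hG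
  have hcomp : ∀ p, widomKernel a f (MeasurableEquiv.shearAddRight ℝ p) = G p := by
    rintro ⟨ξ, d⟩
    show widomU (a ξ) (a (ξ + d)) f / ((|ξ - (ξ + d)| ^ 2 : ℝ) : ℂ) = _
    rw [sub_add_cancel_left, abs_neg]
  have hGm : Measurable G := by
    have h1 : Measurable fun p : ℝ × ℝ => (a p.1, a (p.1 + p.2)) :=
      (ha.comp measurable_fst).prodMk (ha.comp (measurable_fst.add measurable_snd))
    have h2 := (measurable_widomU hf.continuous).comp h1
    have h3 : Measurable fun p : ℝ × ℝ => ((|p.2| ^ 2 : ℝ) : ℂ) := by fun_prop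
    exact h2.div h3
  have hrest : ((volume : Measure ℝ).prod volume).restrict (Set.univ ×ˢ D) =
      (volume : Measure ℝ).prod (volume.restrict D) := by
    rw [← Measure.prod_restrict, Measure.restrict_univ]
  have hDint : IntegrableOn (fun d : ℝ => (|d| ^ 2)⁻¹) D := by
    rw [← integrable_indicator_iff hDm]
    refine (integrable_indicator_Ioi_abs hε).congr (ae_of_all _ fun d => ?_)
    simp only [Set.indicator_apply, hD, Set.mem_Ioi]
    show (if ε < |d| then _ else _) = if ε < |d| then _ else _
    rw [Real.rpow_neg (abs_nonneg d), Real.rpow_two]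
  have hGi : Integrable G ((volume : Measure ℝ).prod (volume.restrict D)) := by
    rw [integrable_prod_iff' hGm.aestronglyMeasurable]
    have hslice : ∀ d, Integrable fun ξ => G (ξ, d) := fun d => by
      simp only [hG]
      exact (hf.integrable_widomU_shift ha hi d).div_const ((|d| ^ 2 : ℝ) : ℂ)
    refine ⟨ae_of_all _ hslice, ?_⟩
    refine (hDint.const_mul (2 * M * betaDiag σ * (2 * ∫ ξ, |a ξ| ^ σ))).mono'
      (hGm.stronglyMeasurable.norm.integral_prod_left').aestronglyMeasurable
      (ae_of_all _ fun d => ?_)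
    have h1 := betaDiag_nonneg σ
    have h2 := hf.const_nonneg
    rw [Real.norm_of_nonneg (integral_nonneg fun _ => norm_nonneg _)]
    have hb : ∀ ξ, ‖G (ξ, d)‖ ≤
        2 * M * betaDiag σ * (|a ξ| ^ σ + |a (ξ + d)| ^ σ) * (|d| ^ 2)⁻¹ := by
      intro ξ
      simp only [hG]
      rw [norm_div, Complex.norm_real, Real.norm_of_nonneg (by positivity), div_eq_mul_inv]
      refine mul_le_mul_of_nonneg_right ((hf.norm_widomU_le _ _).trans ?_) (by positivity)
      exact mul_le_mul_of_nonneg_left (rpow_abs_sub_le hf.exponent_pos hf.exponent_lt.le _ _)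
        (by positivity)
    have hsum : Integrable fun ξ => |a ξ| ^ σ + |a (ξ + d)| ^ σ := hi.add (hi.comp_add_right d)
    refine (integral_mono (hslice d).norm ((hsum.const_mul _).mul_const _) hb).trans_eq ?_
    rw [integral_mul_const, integral_const_mul, integral_add hi (hi.comp_add_right d),
      integral_add_right_eq_self (fun ξ => |a ξ| ^ σ)]
    ring
  constructor
  · have h := hmp.integrableOn_comp_preimage hemb (f := widomKernel a f) (s := S)
    rw [hpre] at h
    refine h.1 ?_
    rw [IntegrableOn, hrest]
    exact hGi.congr (ae_of_all _ fun p => (hcomp p).symm)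
  · have h := hmp.setIntegral_preimage_emb hemb (widomKernel a f) S
    rw [hpre, hrest] at h
    simp only [hcomp] at h
    rw [widomTruncated]
    refine h.symm.trans ?_
    rw [integral_prod_symm _ hGi]
    simp only [hG, integral_div, widomShift]

end HolderOffPoint

theorem tendsto_setIntegral_lt_abs {g : ℝ → ℂ} (hg : Integrable g) :
    Tendsto (fun ε : ℝ => ∫ d in {d : ℝ | ε < |d|}, g d) (𝓝[>] 0) (𝓝 (∫ d, g d)) := by
  have hm : ∀ ε : ℝ, MeasurableSet {d : ℝ | ε < |d|} := fun ε =>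
    measurableSet_lt measurable_const (by fun_prop)
  simp only [← integral_indicator (hm _)]
  refine tendsto_integral_filter_of_dominated_convergence (fun d => ‖g d‖)
    (Eventually.of_forall fun ε => hg.aestronglyMeasurable.indicator (hm ε))
    (Eventually.of_forall fun ε => ae_of_all _ fun d => norm_indicator_le_norm_self _ _) hg.norm ?_
  have h0 : ∀ᵐ d : ℝ, d ≠ 0 := by simp [ae_iff]
  filter_upwards [h0] with d hd
  refine tendsto_const_nhds.congr' ?_
  filter_upwards [Ioo_mem_nhdsGT (abs_pos.2 hd)] with ε hε
  exact (Set.indicator_of_mem (by exact hε.2) _).symm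

theorem theorem8p1 (h : ℝ → ℝ) (μ : ℝ) (hh : FermiSurfaceCondition h μ)
    (f : ℝ → ℂ) (n : ℕ) (hn : 1 ≤ n) (t₀ γ R : ℝ) (hγ : 0 < γ) (hR : 0 < R) (hR1 : R ≤ 1)
    (hf : HolderTypeCondition f n t₀ γ R) :
    IntervalIntegrable (widomUIntegrand 1 0 f) volume 0 1 ∧
    (∀ᶠ T : ℝ in 𝓝[>] 0, WidomCoefficientExists (fermiSymbol h T μ) f) ∧
    (fun T : ℝ => widomCoefficient (fermiSymbol h T μ) f -
        ((fermiSeaComponents h μ : ℂ) / (2 * (Real.pi : ℂ) ^ 2)) * widomU 1 0 f *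
          ((|Real.log T| : ℝ) : ℂ))
      =O[𝓝[>] 0] (fun _ : ℝ => (1 : ℝ)) := by
  obtain ⟨σ, M, hF⟩ := hf.exists_holderOffPoint hn hγ hR1
  obtain ⟨k, C, β, κ, L, hv⟩ := hh.exists_regularDispersion
  set v : ℝ → ℝ := fun ξ => h ξ - μ with hv_def
  have hset : {ξ | v ξ < 0} = {ξ | h ξ < μ} := by
    ext ξ
    show h ξ - μ < 0 ↔ h ξ < μ
    exact sub_neg
  have hfin : Finite (ConnectedComponents {ξ | v ξ < 0}) := by
    rw [hset]; exact hh.finite_components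
  have hN : Nat.card (ConnectedComponents {ξ | v ξ < 0}) = fermiSeaComponents h μ := by
    rw [hset]; rfl
  obtain ⟨r₀, hr₀, hr₀'⟩ := Metric.eventually_nhds_iff.1 (hv.eventually_crossing_eq hfin)
  rw [hN] at hr₀'
  obtain ⟨C₁, hC₁, hsmall⟩ := hv.exists_norm_widomShift_le_of_abs_le hF
  obtain ⟨C₂, hC₂, hlarge⟩ := hv.exists_norm_widomShift_sub_le hF
  -- The slope of J in |d|: the crossing measure 2N|d| times U(1,0;f).
  set A : ℂ := 2 * (fermiSeaComponents h μ : ℂ) * widomU 1 0 f with hA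
  set V : ℝ := 2 * ∫ ξ, {ξ | v ξ < 0}.indicator (1 : ℝ → ℝ) ξ with hV
  -- A bound for J at every d, using T < 1 and the fact that the crossing measure is at most twice
  -- the measure of the Fermi sea.
  set C₃ : ℝ := C₂ + ‖widomU 1 0 f‖ * V with hC₃
  set K : ℝ := 2 * C₁ + 2 * C₂ + 2 * C₃ / (r₀ / 2) + 2 * ‖A‖ * |Real.log (r₀ / 2)| with hK
  have hmain : ∀ᶠ T : ℝ in 𝓝[>] 0, WidomCoefficientExists (fermiSymbol h T μ) f ∧
      ∃ ℓ : ℂ, Tendsto (widomTruncated (fermiSymbol h T μ) f) (𝓝[>] (0 : ℝ)) (𝓝 ℓ) ∧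
        ‖ℓ - 2 * A * (|Real.log T| : ℝ)‖ ≤ K := by
    filter_upwards [hsmall, hlarge, hv.eventually_integrable_rpow hF.exponent_pos
      hF.exponent_lt.le, Ioo_mem_nhdsGT (lt_min zero_lt_one (half_pos hr₀))] with T h1 h2 h3 hT
    have hT0 : 0 < T := hT.1
    have hT1 : T < 1 := hT.2.trans_le (min_le_left _ _)
    have hTr : T < r₀ / 2 := hT.2.trans_le (min_le_right _ _)
    have ha : fermiSymbol h T μ = fun ξ => fermiFun (v ξ / T) := rfl
    rw [ha]
    have hm := hv.measurable_fermiFun_div T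
    obtain ⟨hJi, hJb⟩ := integrable_div_sq_and_norm_integral_sub_log_le (A := A) (r := r₀ / 2)
      (C₃ := C₃) (measurable_widomShift hF.continuous hm) hT0 hT1.le hTr hC₂ h1 (fun d hd => by
        have hcr := hr₀' (y := d) (by rw [Real.dist_eq, sub_zero]; linarith)
        have := h2 d
        rw [hcr] at this
        refine le_trans (le_of_eq ?_) this
        congr 2
        rw [hA]; push_cast; ring) (fun d => by
        have e : widomShift (fun ξ => fermiFun (v ξ / T)) f d =
            (widomShift (fun ξ => fermiFun (v ξ / T)) f d -
              widomU 1 0 f * (RegularDispersion.crossing v d : ℝ)) +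
              widomU 1 0 f * (RegularDispersion.crossing v d : ℝ) := by ring
        rw [e]
        refine (norm_add_le _ _).trans (add_le_add ((h2 d).trans (by nlinarith)) ?_)
        rw [norm_mul, Complex.norm_real,
          Real.norm_of_nonneg (RegularDispersion.crossing_nonneg v d)]
        gcongr
        exact hv.crossing_le d)
    have hlim : Tendsto (widomTruncated (fun ξ => fermiFun (v ξ / T)) f) (𝓝[>] (0 : ℝ))
        (𝓝 (∫ d, widomShift (fun ξ => fermiFun (v ξ / T)) f d / ((|d| ^ 2 : ℝ) : ℂ))) := by
      refine (tendsto_setIntegral_lt_abs hJi).congr' ?_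
      filter_upwards [self_mem_nhdsWithin] with ε hε
      exact (hF.widomTruncated_eq hm h3 hε).2.symm
    exact ⟨⟨fun _ _ => hF.intervalIntegrable_widomUIntegrand _ _,
      fun ε hε => (hF.widomTruncated_eq hm h3 hε).1, _, hlim⟩, _, hlim, hJb⟩
  refine ⟨hF.intervalIntegrable_widomUIntegrand 1 0, hmain.mono fun T hT => hT.1, ?_⟩
  refine IsBigO.of_bound (‖(1 : ℂ) / (8 * (Real.pi : ℂ) ^ 2)‖ * K) ?_
  filter_upwards [hmain] with T hT
  obtain ⟨-, ℓ, hℓ, hb⟩ := hT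
  -- Convergence has been proved, so `limUnder` is the actual limit and not a default value.
  rw [widomCoefficient, hℓ.limUnder_eq, norm_one, mul_one]
  have e : 1 / (8 * (Real.pi : ℂ) ^ 2) * ℓ -
      (fermiSeaComponents h μ : ℂ) / (2 * (Real.pi : ℂ) ^ 2) * widomU 1 0 f *
        ((|Real.log T| : ℝ) : ℂ) =
      1 / (8 * (Real.pi : ℂ) ^ 2) * (ℓ - 2 * A * (|Real.log T| : ℝ)) := by
    have hpi : (Real.pi : ℂ) ≠ 0 := by exact_mod_cast Real.pi_ne_zero
    rw [hA]
    field_simp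
    ring
  rw [e, norm_mul]
  gcongr
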